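/- Let $d\ge 1$ and let $w:\mathbb{R}^d\to\mathbb{C}$ be continuous with support contained in $[0,1]^d$. For $\gamma=(s,\xi)$ with $s>0$, $\xi\in\mathbb{R}^d$, put $g_\gamma(t)=g_{s,\xi}(t)=w(t/s)\,e^{i\xi\cdot t}$. Let $\lambda:\mathbb{R}^d\to\mathbb{R}$ be continuous with $0<\inf\lambda\le\sup\lambda<\infty$, let $N=\sum_{j\ge1}\delta_{t_j}$ be a Poisson point process on $\mathbb{R}^d$ with intensity function $\lambda$, let $(A_j)_{j\ge1}$ be i.i.d. real random variables independent of the points $(t_j)_{j\ge 1}$, and let $Y=\sum_{j}A_j\delta_{t_j}$, so that $(g_\gamma*Y)(t)=\sum_j A_j\,g_\gamma(t-t_j)$. For $1\le p,p'<\infty$ let $$S_{\gamma,p,\gamma',p'}Y(t)=\mathbb{E}\Big[\big|\big(|g_\gamma*Y|^p*g_{\gamma'}\big)(t)\big|^{p'}\Big],\qquad SY(\gamma,p,\gamma',p')=\lim_{R\to\infty}\frac1{(2R)^d}\int_{|t_i|\le R\ \forall i}S_{\gamma,p,\gamma',p'}Y(t)\,dt$$ (the latter if the limit exists). Let $1\le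 p,p'<\infty$ and $q=pp'$, and assume $\mathbb{E}|A_1|^q<\infty$. Let $\gamma_k=(s_k,\xi_k)$ and $\gamma_k'=(s_k',\xi_k')$ be sequences of scale and frequency pairs such that $s_k>0$, $s_k\to0$, $s_k'=c\,s_k$ for a fixed constant $c>0$, and $s_k'\xi_k'\to L\in\mathbb{R}^d$. Then all the moments $S_{\gamma_k,p,\gamma_k',p'}Y(t)$ are finite and, for every $t\in\mathbb{R}^d$, $$\lim_{k\to\infty}\frac{S_{\gamma_k,p,\gamma_k',p'}Y(t)}{s_k^{d(p'+1)}}=K\,\lambda(t)\,\mathbb{E}[|A_1|^q],\qquad K=\big\|g_{c,L/c}*|g_{1,0}|^p\big\|_{p'}^{p'}.$$ Furthermore, if $\lambda$ is periodic with period $T>0$ along each coordinate, then the invariant moments $SY(\gamma_k,p,\gamma_k',p')$ exist and $$\lim_{k\to\infty}\frac{SY(\gamma_k,p,\gamma_k',p')}{s_k^{d(p'+1)}}=K\,m_1(\lambda)\,\mathbb{E}[|A_1|^q],\qquad m_1(\lambda)=\frac1{T^d}\int_{[0,T]^d}\lambda(t)\,dt.$$ -/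

import Mathlib

open MeasureTheory ProbabilityTheory Filter Topology
open scoped ENNReal Convolution Nat

noncomputable section

namespace Scattering

/-- The cube `[0, a]^d`. -/
def cube (d : ℕ) (a : ℝ) : Set (EuclideanSpace ℝ (Fin d)) :=
  {t | ∀ i, 0 ≤ t i ∧ t i ≤ a}

/-- The centred cube `{t : |t_i| ≤ R for all i}`. -/
def centredCube (d : ℕ) (R : ℝ) : Set (EuclideanSpace ℝ (Fin d)) :=
  {t | ∀ i, |t i| ≤ R}

/-- The Gabor-type filter `g_{(s, ξ)}(t) = w(t / s) exp(i ξ · t)`. -/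
def gabor {d : ℕ} (w : EuclideanSpace ℝ (Fin d) → ℂ) (s : ℝ) (ξ : EuclideanSpace ℝ (Fin d)) :
    EuclideanSpace ℝ (Fin d) → ℂ :=
  fun t => w (s⁻¹ • t) * Complex.exp (Complex.I * ((inner ℝ ξ t : ℝ) : ℂ))

/-- `Λ(B) = ∫_B λ(t) dt`, with values in `[0, ∞]`. -/
def intensityMeasure {d : ℕ} (lam : EuclideanSpace ℝ (Fin d) → ℝ)
    (B : Set (EuclideanSpace ℝ (Fin d))) : ℝ≥0∞ :=
  ∫⁻ t in B, ENNReal.ofReal (lam t)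

/-- The random counting measure `N = ∑_j δ_{t_j}` of a sequence of random points. -/
def pointMeasure {d : ℕ} {Ω : Type*} (τ : ℕ → Ω → EuclideanSpace ℝ (Fin d)) (ω : Ω) :
    Measure (EuclideanSpace ℝ (Fin d)) :=
  Measure.sum fun j => Measure.dirac (τ j ω)

/-- `N = ∑_j δ_{t_j}` is a Poisson point process with intensity function `lam`: counts are
Poisson with parameter `Λ(B)`, and counts in pairwise disjoint sets are independent. -/
structure IsPoissonProcess {d : ℕ} {Ω : Type*} [MeasurableSpace Ω] (P : Measure Ω)
    (lam : EuclideanSpace ℝ (Fin d) → ℝ) (τ : ℕ → Ω → EuclideanSpace ℝ (Fin d)) : Prop where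
  measurable : ∀ j, Measurable (τ j)
  poisson : ∀ B : Set (EuclideanSpace ℝ (Fin d)), MeasurableSet B →
    intensityMeasure lam B ≠ ∞ → ∀ n : ℕ,
      P {ω | pointMeasure τ ω B = n} =
        ENNReal.ofReal (Real.exp (-(intensityMeasure lam B).toReal) *
          (intensityMeasure lam B).toReal ^ n / (n ! : ℝ))
  indep : ∀ (m : ℕ) (B : Fin m → Set (EuclideanSpace ℝ (Fin d))),
    (∀ i, MeasurableSet (B i)) → (∀ i j, i ≠ j → Disjoint (B i) (B j)) →
      iIndepFun (fun i ω => pointMeasure τ ω (B i)) P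

/-- `Y = ∑_j A_j δ_{t_j}` is a compound Poisson point process: the points form a Poisson point
process with intensity function `lam`, the charges `A_j` are real, independent and identically
distributed, and the sequence of charges is independent of the points. -/
structure IsCompoundPoisson {d : ℕ} {Ω : Type*} [MeasurableSpace Ω] (P : Measure Ω)
    (lam : EuclideanSpace ℝ (Fin d) → ℝ) (τ : ℕ → Ω → EuclideanSpace ℝ (Fin d))
    (A : ℕ → Ω → ℝ) : Prop where
  points : IsPoissonProcess P lam τ
  measurable : ∀ j, Measurable (A j)
  iIndep : iIndepFun A P
  identDistrib : ∀ j, IdentDistrib (A j) (A 0) P P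
  indep_points : IndepFun (fun ω j => A j ω) (fun ω j => τ j ω) P

/-- `(g * Y)(t) = ∫ g(t - u) Y(du) = ∑_j A_j g(t - t_j)`. -/
def response {d : ℕ} {Ω : Type*} (τ : ℕ → Ω → EuclideanSpace ℝ (Fin d)) (A : ℕ → Ω → ℝ)
    (g : EuclideanSpace ℝ (Fin d) → ℂ) (ω : Ω) (t : EuclideanSpace ℝ (Fin d)) : ℂ :=
  ∑' j, (A j ω : ℂ) * g (t - τ j ω)

/-- `(|g * Y|^p * g')(t)`. -/
def secondResponse {d : ℕ} {Ω : Type*} (τ : ℕ → Ω → EuclideanSpace ℝ (Fin d)) (A : ℕ → Ω → ℝ)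
    (g : EuclideanSpace ℝ (Fin d) → ℂ) (p : ℝ) (g' : EuclideanSpace ℝ (Fin d) → ℂ)
    (ω : Ω) (t : EuclideanSpace ℝ (Fin d)) : ℂ :=
  ((fun u => ‖response τ A g ω u‖ ^ p) ⋆ g') t

/-- The second-order scattering moment `E[ | (|g * Y|^p * g')(t) |^{p'} ]`. -/
def secondMoment {d : ℕ} {Ω : Type*} [MeasurableSpace Ω] (P : Measure Ω)
    (τ : ℕ → Ω → EuclideanSpace ℝ (Fin d)) (A : ℕ → Ω → ℝ)
    (g : EuclideanSpace ℝ (Fin d) → ℂ) (p : ℝ) (g' : EuclideanSpace ℝ (Fin d) → ℂ) (p' : ℝ)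
    (t : EuclideanSpace ℝ (Fin d)) : ℝ :=
  ∫ ω, ‖secondResponse τ A g p g' ω t‖ ^ p' ∂P

/-- `S` is locally integrable and `(2R)^{-d} ∫_{|t_i| ≤ R} S(t) dt` converges to `m` as
`R → ∞`: the invariant moment that belongs to the location dependent moment `S` exists and
equals `m`. -/
def HasInvariantMoment {d : ℕ} (S : EuclideanSpace ℝ (Fin d) → ℝ) (m : ℝ) : Prop :=
  LocallyIntegrable S volume ∧
    Tendsto (fun R : ℝ => ((2 * R) ^ d)⁻¹ * ∫ t in centredCube d R, S t) atTop (𝓝 m)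

/-- The constant `K = ‖g_{c, L/c} * |g_{1,0}|^p‖_{p'}^{p'}`. -/
def constK {d : ℕ} (w : EuclideanSpace ℝ (Fin d) → ℂ) (p p' c : ℝ)
    (L : EuclideanSpace ℝ (Fin d)) : ℝ :=
  (eLpNorm ((fun u => ‖gabor w 1 0 u‖ ^ p) ⋆ gabor w c (c⁻¹ • L))
    (ENNReal.ofReal p') volume).toReal ^ p'

/-- `m_1(λ) = T^{-d} ∫_{[0,T]^d} λ(t) dt`. -/
def meanIntensity {d : ℕ} (lam : EuclideanSpace ℝ (Fin d) → ℝ) (T : ℝ) : ℝ :=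
  (T ^ d)⁻¹ * ∫ t in cube d T, lam t

end Scattering

end

open Scattering

/-! A response at `t` sees only the points in the window `t - [0, s + s']^d`. The expected number of
points there is of order `s^d`, so for small `s` the window typically holds none, and the leading
term comes from exactly one point. A single point `x` with charge `a` makes the first layer `|a|^p
|g(u - x)|^p`, in which the frequency `ξ` has disappeared. The second layer is then `|a|^p` times
the envelope `(|g|^p * g')(t - x)`, and the `p'`-th power of its modulus splits off the factor
`|a|^q` (`shotPower_of_hits_le_one`). Campbell's formula and independence of the charges average
this to `E|A|^q ∫ |envelope(t - x)|^{p'} λ(x) dx`. The substitution `x = t - s z` takes `s^{dp'}`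
out of the envelope and `s^d` out of the volume (`lintegral_envelope_mul`). What remains is
`profile`, where the frequency occurs only through `s ξ'`, which tends to `L / c`; dominated
convergence turns it into `K λ(t)`.

Two or more points are handled by a crude bound: power means give `‖g'‖_1^{p'} n^{q-1} ∑ |A_j|^q` up
to a constant, with `n` the number of points in the window. Its mean over `n ≥ 2` is `s^{dp'}` times
a truncated Poisson moment of size `O(s^{2d})`. After division by `s^{d(p'+1)}` the error is
`O(s^d)`, uniformly in `t` and in the frequencies (`exists_abs_secondMoment_sub_le`).

For the invariant moments one needs `t ↦ S(t)` to be periodic. Translating the process by a period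
gives another process with the same intensity, but the definition fixes only the laws of the counts,
not of the enumerated points. That the moments depend on the counts alone is shown first for kernels
with finitely many values on the window, using exchangeability of the charges, and then by
approximation (`lintegral_shotPower_eq`). The average over large cubes is then the average over one
period, and a bound uniform in `k` and `t` lets the pointwise limit pass under that integral. -/

namespace Scattering

/-! ### Deterministic bounds for shot noise, and the one-point identity. -/

variable {X U : Type*}

/-- The field `u ↦ ∑_j a_j κ(x_j, u)`. -/
noncomputable def shotNoise (κ : X → U → ℂ) (x : ℕ → X) (a : ℕ → ℝ) (u : U) : ℂ :=
  ∑' j, (a j : ℂ) * κ (x j) u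

/-- The integral of `|∑_j a_j κ(x_j, u)|^p` against `ψ`. -/
noncomputable def shotTransform [MeasureSpace U] (κ : X → U → ℂ) (ψ : U → ℂ) (p : ℝ)
    (x : ℕ → X) (a : ℕ → ℝ) : ℂ :=
  ∫ u, (‖shotNoise κ x a u‖ ^ p) • ψ u

/-- The `p'`-th power of the modulus of `shotTransform`. -/
noncomputable def shotPower [MeasureSpace U] (κ : X → U → ℂ) (ψ : U → ℂ) (p p' : ℝ)
    (x : ℕ → X) (a : ℕ → ℝ) : ℝ≥0∞ :=
  ENNReal.ofReal (‖shotTransform κ ψ p x a‖ ^ p')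

/-- The contribution of a single unit charge at `x` to `shotPower`. -/
noncomputable def singlePower [MeasureSpace U] (κ : X → U → ℂ) (ψ : U → ℂ) (p p' : ℝ)
    (x : X) : ℝ≥0∞ :=
  ENNReal.ofReal (‖∫ u, (‖κ x u‖ ^ p) • ψ u‖ ^ p')

/-- The number of indices `j` with `x_j ∈ B`. -/
noncomputable def hits (B : Set X) (x : ℕ → X) : ℝ≥0∞ :=
  ∑' j, B.indicator 1 (x j)

theorem measurable_hits [MeasurableSpace X] {B : Set X} (hB : MeasurableSet B) :
    Measurable (hits B) := by
  refine Measurable.tsum fun j => ?_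
  exact (measurable_one.indicator hB).comp (measurable_pi_apply j)

theorem hits_eq_encard (B : Set X) (x : ℕ → X) : hits B x = ((x ⁻¹' B).encard : ℝ≥0∞) := by
  have h : hits B x = ∑' j, (x ⁻¹' B).indicator (1 : ℕ → ℝ≥0∞) j := rfl
  rw [h, ← tsum_subtype]
  simp

theorem finite_of_hits_ne_top {B : Set X} {x : ℕ → X} (h : hits B x ≠ ∞) :
    (x ⁻¹' B).Finite := by
  rw [hits_eq_encard] at h
  by_contra hc
  rw [Set.not_finite] at hc
  simp [hc.encard_eq] at h

theorem hits_eq_card {B : Set X} {x : ℕ → X} (h : (x ⁻¹' B).Finite) :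
    hits B x = (h.toFinset.card : ℝ≥0∞) := by
  rw [hits_eq_encard, h.encard_eq_coe_toFinset_card]
  simp

theorem shotNoise_eq_sum {κ : X → U → ℂ} {x : ℕ → X} {a : ℕ → ℝ} (s : Finset ℕ) (hs : ∀ j ∉ s, ∀ u, κ (x j) u = 0) (u : U) :
    shotNoise κ x a u = ∑ j ∈ s, (a j : ℂ) * κ (x j) u :=
  tsum_eq_sum fun j hj => by rw [hs j hj u, mul_zero]

/-- The power mean inequality. Keeping `∑ |a j| ^ p` rather than the power of a sum makes the bound
linear in functions of the individual charges, which can later be averaged one at a time. -/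
theorem norm_shotNoise_rpow_le {κ : X → U → ℂ} {x : ℕ → X} {a : ℕ → ℝ} {p M : ℝ} (hp : 1 ≤ p)
    (hM0 : 0 ≤ M) (s : Finset ℕ) (hs : ∀ j ∉ s, ∀ u, κ (x j) u = 0) (hM : ∀ y u, ‖κ y u‖ ≤ M) (u : U) :
    ‖shotNoise κ x a u‖ ^ p ≤ (s.card : ℝ) ^ (p - 1) * (∑ j ∈ s, |a j| ^ p) * M ^ p := by
  rw [shotNoise_eq_sum s hs]
  have h1 : ‖∑ j ∈ s, (a j : ℂ) * κ (x j) u‖ ≤ ∑ j ∈ s, |a j| * M := by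
    refine (norm_sum_le _ _).trans (Finset.sum_le_sum fun j _ => ?_)
    rw [norm_mul, Complex.norm_real, Real.norm_eq_abs]
    exact mul_le_mul_of_nonneg_left (hM _ _) (abs_nonneg _)
  calc ‖∑ j ∈ s, (a j : ℂ) * κ (x j) u‖ ^ p ≤ (∑ j ∈ s, |a j| * M) ^ p := by gcongr
    _ ≤ (s.card : ℝ) ^ (p - 1) * ∑ j ∈ s, (|a j| * M) ^ p := by
      have := Real.rpow_sum_le_const_mul_sum_rpow s (fun j => |a j| * M) hp
      simpa [abs_mul, abs_of_nonneg hM0] using this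
    _ = _ := by
      rw [mul_assoc, Finset.sum_mul]
      congr 1
      exact Finset.sum_congr rfl fun j _ => Real.mul_rpow (abs_nonneg _) hM0

section
variable [MeasurableSpace X]

theorem measurable_shotNoise [MeasurableSpace U] {κ : X → U → ℂ}
    (hκ : Measurable (Function.uncurry κ)) :
    Measurable fun z : ((ℕ → X) × (ℕ → ℝ)) × U => shotNoise κ z.1.1 z.1.2 z.2 := by
  refine Measurable.tsum fun j => ?_
  have h1 : Measurable fun z : ((ℕ → X) × (ℕ → ℝ)) × U => (z.1.1 j, z.2) := by fun_prop
  have h2 : Measurable fun z : ((ℕ → X) × (ℕ → ℝ)) × U => κ (z.1.1 j) z.2 := hκ.comp h1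
  have h3 : Measurable fun z : ((ℕ → X) × (ℕ → ℝ)) × U => ((z.1.2 j : ℝ) : ℂ) := by fun_prop
  exact h3.mul h2

theorem measurable_shotTransform [MeasureSpace U] [SFinite (volume : Measure U)]
    {κ : X → U → ℂ} (hκ : Measurable (Function.uncurry κ)) {ψ : U → ℂ} (hψ : Measurable ψ)
    (p : ℝ) :
    Measurable fun z : (ℕ → X) × (ℕ → ℝ) => shotTransform κ ψ p z.1 z.2 := by
  have h : StronglyMeasurable fun z : ((ℕ → X) × (ℕ → ℝ)) × U =>
      (‖shotNoise κ z.1.1 z.1.2 z.2‖ ^ p) • ψ z.2 :=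
    (((measurable_shotNoise hκ).norm.pow_const p).smul
      (hψ.comp measurable_snd)).stronglyMeasurable
  exact h.integral_prod_right.measurable

theorem measurable_shotPower [MeasureSpace U] [SFinite (volume : Measure U)]
    {κ : X → U → ℂ} (hκ : Measurable (Function.uncurry κ)) {ψ : U → ℂ} (hψ : Measurable ψ)
    (p p' : ℝ) :
    Measurable fun z : (ℕ → X) × (ℕ → ℝ) => shotPower κ ψ p p' z.1 z.2 :=
  ((measurable_shotTransform hκ hψ p).norm.pow_const p').ennreal_ofReal

theorem measurable_shotPower_right [MeasureSpace U] [SFinite (volume : Measure U)]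
    {κ : X → U → ℂ} (hκ : Measurable (Function.uncurry κ)) {ψ : U → ℂ} (hψ : Measurable ψ)
    (p p' : ℝ) (x : ℕ → X) : Measurable fun a => shotPower κ ψ p p' x a := by
  have hpair : Measurable fun a : ℕ → ℝ => (x, a) := by fun_prop
  have h := (measurable_shotPower hκ hψ p p').comp hpair
  exact h

theorem measurable_singlePower [MeasureSpace U] [SFinite (volume : Measure U)]
    {κ : X → U → ℂ} (hκ : Measurable (Function.uncurry κ)) {ψ : U → ℂ} (hψ : Measurable ψ)
    (p p' : ℝ) : Measurable (singlePower κ ψ p p') := by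
  have h : StronglyMeasurable fun z : X × U => (‖κ z.1 z.2‖ ^ p) • ψ z.2 :=
    ((hκ.norm.pow_const p).smul (hψ.comp measurable_snd)).stronglyMeasurable
  exact (h.integral_prod_right.measurable.norm.pow_const p').ennreal_ofReal

end

section
variable [MeasureSpace U] {κ : X → U → ℂ} {ψ : U → ℂ} {p p' : ℝ} {B : Set X} {M : ℝ}
  {x : ℕ → X} {a : ℕ → ℝ}

/-- Power means are used twice, with exponents `p` and `p'`; the powers of the cardinality combine
as `(p - 1) p' + (p' - 1) = p p' - 1`. -/
theorem norm_shotTransform_rpow_le (hp : 1 ≤ p) (hp' : 1 ≤ p') (hM0 : 0 ≤ M) (s : Finset ℕ)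
    (hs : ∀ j ∉ s, ∀ u, κ (x j) u = 0) (hM : ∀ y u, ‖κ y u‖ ≤ M) (hψ : Integrable ψ) :
    ‖shotTransform κ ψ p x a‖ ^ p' ≤ (M ^ p * ∫ u, ‖ψ u‖) ^ p' *
      ((s.card : ℝ) ^ (p * p' - 1) * ∑ j ∈ s, |a j| ^ (p * p')) := by
  set I := ∫ u, ‖ψ u‖ with hI
  have hI0 : 0 ≤ I := integral_nonneg fun _ => norm_nonneg _
  have hMp : 0 ≤ M ^ p := Real.rpow_nonneg hM0 p
  have hS0 : 0 ≤ ∑ j ∈ s, |a j| ^ p := Finset.sum_nonneg fun j _ => by positivity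
  have h1 : ‖shotTransform κ ψ p x a‖ ≤
      (s.card : ℝ) ^ (p - 1) * (∑ j ∈ s, |a j| ^ p) * M ^ p * I := by
    rw [hI, ← integral_const_mul]
    refine norm_integral_le_of_norm_le (hψ.norm.const_mul _) (Eventually.of_forall fun u => ?_)
    rw [norm_smul, Real.norm_of_nonneg (by positivity)]
    exact mul_le_mul_of_nonneg_right (norm_shotNoise_rpow_le hp hM0 s hs hM u) (norm_nonneg _)
  have h2 : (∑ j ∈ s, |a j| ^ p) ^ p' ≤ (s.card : ℝ) ^ (p' - 1) * ∑ j ∈ s, |a j| ^ (p * p') := by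
    have := Real.rpow_sum_le_const_mul_sum_rpow s (fun j => |a j| ^ p) hp'
    have h3 : ∀ j, |(|a j| ^ p)| = |a j| ^ p := fun j => abs_of_nonneg (by positivity)
    simp only [h3, ← Real.rpow_mul (abs_nonneg _)] at this
    exact this
  -- Adding real exponents needs a positive base, so the empty configuration is treated apart.
  rcases s.eq_empty_or_nonempty with rfl | hne
  · have h0 : ‖shotTransform κ ψ p x a‖ = 0 := by
      apply le_antisymm _ (norm_nonneg _)
      simpa using h1
    rw [h0, Real.zero_rpow (by linarith)]
    simp
  have hc : (0 : ℝ) < s.card := by exact_mod_cast hne.card_pos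
  calc ‖shotTransform κ ψ p x a‖ ^ p'
      ≤ ((s.card : ℝ) ^ (p - 1) * (∑ j ∈ s, |a j| ^ p) * M ^ p * I) ^ p' := by gcongr
    _ = (M ^ p * I) ^ p' * (((s.card : ℝ) ^ (p - 1)) ^ p' * (∑ j ∈ s, |a j| ^ p) ^ p') := by
      rw [← Real.mul_rpow (by positivity) hS0, ← Real.mul_rpow (by positivity) (by positivity)]
      ring_nf
    _ ≤ (M ^ p * I) ^ p' * (((s.card : ℝ) ^ (p - 1)) ^ p' *
        ((s.card : ℝ) ^ (p' - 1) * ∑ j ∈ s, |a j| ^ (p * p'))) := by gcongr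
    _ = _ := by
      rw [← mul_assoc (((s.card : ℝ) ^ (p - 1)) ^ p'), ← Real.rpow_mul hc.le,
        ← Real.rpow_add hc]
      ring_nf

/-- Points outside `B` do not contribute to a weighted sum that vanishes off `B`. -/
theorem tsum_weight_eq_sum (hfin : (x ⁻¹' B).Finite) (c : ℕ → ℝ≥0∞) {f : X → ℝ≥0∞}
    (hf : ∀ y ∉ B, f y = 0) :
    ∑' j, c j * f (x j) = ∑ j ∈ hfin.toFinset, c j * f (x j) :=
  tsum_eq_sum fun j hj => by rw [hf _ (by simpa using hj), mul_zero]

/-- Rounding the exponent `p p' - 1` up to a natural number `m` turns the mean of the bound into an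
integer moment of a Poisson variable. The rounding is harmless: the count is either at least one, or
zero with an empty sum. -/
theorem shotPower_le (hp : 1 ≤ p) (hp' : 1 ≤ p') (hM0 : 0 ≤ M)
    (hκ : ∀ y ∉ B, ∀ u, κ y u = 0) (hM : ∀ y u, ‖κ y u‖ ≤ M) (hψ : Integrable ψ)
    (hfin : hits B x ≠ ∞) {m : ℕ} (hm : p * p' - 1 ≤ m) :
    shotPower κ ψ p p' x a ≤ ENNReal.ofReal ((M ^ p * ∫ u, ‖ψ u‖) ^ p') *
      (hits B x ^ m * ∑' j, ENNReal.ofReal (|a j| ^ (p * p')) * B.indicator 1 (x j)) := by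
  have hf := finite_of_hits_ne_top hfin
  have hs : ∀ j ∉ hf.toFinset, ∀ u, κ (x j) u = 0 := fun j hj => hκ _ (by simpa using hj)
  rw [hits_eq_card hf, tsum_weight_eq_sum hf _ (fun y hy => Set.indicator_of_notMem hy _)]
  have h1 : ∑ j ∈ hf.toFinset, ENNReal.ofReal (|a j| ^ (p * p')) *
      B.indicator (1 : X → ℝ≥0∞) (x j) =
      ENNReal.ofReal (∑ j ∈ hf.toFinset, |a j| ^ (p * p')) := by
    rw [ENNReal.ofReal_sum_of_nonneg fun j _ => by positivity]
    refine Finset.sum_congr rfl fun j hj => ?_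
    rw [Set.indicator_of_mem (by simpa using hj)]
    simp
  have h2 := norm_shotTransform_rpow_le (a := a) hp hp' hM0 hf.toFinset hs hM hψ
  set n := hf.toFinset.card with hn
  have hI0 : 0 ≤ ∫ u, ‖ψ u‖ := integral_nonneg fun _ => norm_nonneg _
  have hMp : 0 ≤ M ^ p := Real.rpow_nonneg hM0 p
  have hC : 0 ≤ (M ^ p * ∫ u, ‖ψ u‖) ^ p' := by positivity
  have hS0 : 0 ≤ ∑ j ∈ hf.toFinset, |a j| ^ (p * p') :=
    Finset.sum_nonneg fun j _ => by positivity
  have h3 : (n : ℝ) ^ (p * p' - 1) * ∑ j ∈ hf.toFinset, |a j| ^ (p * p') ≤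
      (n : ℝ) ^ m * ∑ j ∈ hf.toFinset, |a j| ^ (p * p') := by
    rcases Nat.eq_zero_or_pos n with h0 | h0
    · have : hf.toFinset = ∅ := Finset.card_eq_zero.mp h0
      simp [this]
    · refine mul_le_mul_of_nonneg_right ?_ hS0
      rw [← Real.rpow_natCast]
      exact Real.rpow_le_rpow_of_exponent_le (by exact_mod_cast h0) hm
  rw [h1, shotPower, ← ENNReal.ofReal_natCast n, ← ENNReal.ofReal_pow (by positivity),
    ← ENNReal.ofReal_mul (by positivity), ← ENNReal.ofReal_mul hC]
  exact ENNReal.ofReal_le_ofReal (h2.trans (mul_le_mul_of_nonneg_left h3 hC))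

theorem singlePower_le (hp : 1 ≤ p) (hp' : 1 ≤ p')
    (hκ : ∀ y ∉ B, ∀ u, κ y u = 0) (hM : ∀ y u, ‖κ y u‖ ≤ M) (hψ : Integrable ψ) (y : X) :
    singlePower κ ψ p p' y ≤
      ENNReal.ofReal ((M ^ p * ∫ u, ‖ψ u‖) ^ p') * B.indicator 1 y := by
  by_cases hy : y ∈ B
  · rw [Set.indicator_of_mem hy, Pi.one_apply, mul_one]
    refine ENNReal.ofReal_le_ofReal (Real.rpow_le_rpow (norm_nonneg _) ?_ (by linarith))
    rw [← integral_const_mul]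
    refine norm_integral_le_of_norm_le (hψ.norm.const_mul _) (Eventually.of_forall fun u => ?_)
    rw [norm_smul, Real.norm_of_nonneg (by positivity)]
    gcongr
    exact hM _ _
  · simp [singlePower, hκ y hy, Real.zero_rpow (by linarith : p ≠ 0),
      Real.zero_rpow (by linarith : p' ≠ 0)]

/-- With a single point, modulus and powers are multiplicative, so the charge factors out exactly;
with no point both sides vanish because `p` and `p'` are nonzero. Writing the result as a sum over
all points makes Campbell's formula applicable. -/
theorem shotPower_of_hits_le_one (hp : 1 ≤ p) (hp' : 1 ≤ p')
    (hκ : ∀ y ∉ B, ∀ u, κ y u = 0) (hle : hits B x ≤ 1) :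
    shotPower κ ψ p p' x a =
      ∑' j, ENNReal.ofReal (|a j| ^ (p * p')) * singlePower κ ψ p p' (x j) := by
  have hf := finite_of_hits_ne_top (hle.trans_lt ENNReal.one_lt_top).ne
  have hs : ∀ j ∉ hf.toFinset, ∀ u, κ (x j) u = 0 := fun j hj => hκ _ (by simpa using hj)
  have hp0 : p ≠ 0 := by linarith
  have hp0' : p' ≠ 0 := by linarith
  rw [tsum_weight_eq_sum hf _ (fun y hy => by simp [singlePower, hκ y hy, hp0, hp0'])]
  rw [hits_eq_card hf] at hle
  have hle' : hf.toFinset.card ≤ 1 := by exact_mod_cast hle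
  rw [shotPower, shotTransform]
  simp only [shotNoise_eq_sum _ hs]
  rcases Nat.le_one_iff_eq_zero_or_eq_one.mp hle' with h0 | h1
  · rw [Finset.card_eq_zero.mp h0]
    simp [hp0, hp0']
  · obtain ⟨j, hj⟩ := Finset.card_eq_one.mp h1
    rw [hj]
    simp only [Finset.sum_singleton, norm_mul, Complex.norm_real, Real.norm_eq_abs,
      Real.mul_rpow (abs_nonneg _) (norm_nonneg _), singlePower, mul_smul, integral_smul]
    rw [norm_smul, Real.norm_of_nonneg (by positivity), Real.mul_rpow (by positivity) (by positivity),
      ← Real.rpow_mul (abs_nonneg _), ENNReal.ofReal_mul (by positivity)]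

end

end Scattering

/-! ### Moments of Poisson variables. -/

namespace Scattering

section Poisson
open NNReal

theorem poissonMeasure_singleton_succ (r : ℝ≥0) (n : ℕ) :
    ((n + 1 : ℕ) : ℝ≥0∞) * poissonMeasure r {n + 1} = r * poissonMeasure r {n} := by
  rw [poissonMeasure_singleton, poissonMeasure_singleton, ← ENNReal.ofReal_natCast,
    ← ENNReal.ofReal_coe_nnreal, ← ENNReal.ofReal_mul (by positivity),
    ← ENNReal.ofReal_mul (by positivity)]
  congr 1
  rw [Nat.factorial_succ]
  push_cast
  field_simp
  ring

theorem lintegral_natCast_poissonMeasure (r : ℝ≥0) :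
    ∫⁻ n : ℕ, (n : ℝ≥0∞) ∂poissonMeasure r = r := by
  rw [lintegral_countable', tsum_eq_zero_add' ENNReal.summable]
  simp only [poissonMeasure_singleton_succ, ENNReal.tsum_mul_left]
  have h : ∑' n, poissonMeasure r {n} = 1 := by
    have := lintegral_countable' (μ := poissonMeasure r) (fun _ => 1)
    simpa using this.symm
  simp [h]

/-- Shifting the index by two exposes the factor `r ^ 2`. The rest is summable uniformly in `r ≤ R`,
since `(n + 2)^k ≤ k! e^{n + 2}` and `(n + 2)! ≥ n!` leave a multiple of the exponential series at
`e R`. This quadratic smallness is what makes multiple points negligible. -/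
theorem exists_lintegral_poissonMeasure_le (R : ℝ≥0) (k : ℕ) :
    ∃ C : ℝ≥0∞, C ≠ ∞ ∧ ∀ r ≤ R,
      ∫⁻ n : ℕ, (if 2 ≤ n then (n : ℝ≥0∞) ^ k else 0) ∂poissonMeasure r ≤ C * r ^ 2 := by
  have hsum : Summable fun n : ℕ =>
      ((k ! : ℝ) * Real.exp 2) * ((Real.exp 1 * R) ^ n / n !) :=
    (Real.summable_pow_div_factorial _).mul_left _
  refine ⟨∑' n : ℕ, ENNReal.ofReal (((k ! : ℝ) * Real.exp 2) * ((Real.exp 1 * R) ^ n / n !)),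
    hsum.tsum_ofReal_ne_top, fun r hr => ?_⟩
  rw [lintegral_countable', tsum_eq_zero_add' ENNReal.summable,
    tsum_eq_zero_add' ENNReal.summable, ← ENNReal.tsum_mul_right]
  have h2 : ∀ n : ℕ, 2 ≤ n + 1 + 1 := fun n => by omega
  simp only [h2, if_true]
  norm_num only
  simp only [if_false, zero_mul, zero_add]
  refine ENNReal.tsum_le_tsum fun n => ?_
  rw [poissonMeasure_singleton, ← ENNReal.ofReal_natCast, ← ENNReal.ofReal_coe_nnreal,
    ← ENNReal.ofReal_pow (by positivity), ← ENNReal.ofReal_pow (by positivity),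
    ← ENNReal.ofReal_mul (by positivity), ← ENNReal.ofReal_mul (by positivity)]
  refine ENNReal.ofReal_le_ofReal ?_
  have h3 : ((n + 1 + 1 : ℕ) : ℝ) ^ k ≤ k ! * (Real.exp 2 * Real.exp 1 ^ n) := by
    have := Real.pow_div_factorial_le_exp ((n + 1 + 1 : ℕ) : ℝ) (by positivity) k
    rw [div_le_iff₀ (by positivity)] at this
    have e : (2 : ℝ) + n * 1 = ((n + 1 + 1 : ℕ) : ℝ) := by push_cast; ring
    rw [← Real.exp_nat_mul, ← Real.exp_add, e]
    linarith
  have h4 : Real.exp (-(r : ℝ)) * (r : ℝ) ^ (n + 1 + 1) / ((n + 1 + 1) ! : ℝ) ≤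
      (R : ℝ) ^ n / n ! * (r : ℝ) ^ 2 := by
    have e1 : Real.exp (-(r : ℝ)) ≤ 1 := Real.exp_le_one_iff.mpr (by simp)
    have e2 : (r : ℝ) ^ n ≤ (R : ℝ) ^ n := by gcongr
    have e3 : ((n !: ℕ) : ℝ) ≤ ((n + 1 + 1)! : ℕ) := by
      exact_mod_cast Nat.factorial_le (by omega)
    calc Real.exp (-(r : ℝ)) * (r : ℝ) ^ (n + 1 + 1) / ((n + 1 + 1) ! : ℝ)
        ≤ 1 * ((R : ℝ) ^ n * (r : ℝ) ^ 2) / (n ! : ℝ) := by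
          have : (r : ℝ) ^ (n + 1 + 1) = (r : ℝ) ^ n * (r : ℝ) ^ 2 := by ring
          rw [this]
          gcongr
      _ = _ := by ring
  calc ((n + 1 + 1 : ℕ) : ℝ) ^ k *
        (Real.exp (-(r : ℝ)) * (r : ℝ) ^ (n + 1 + 1) / ((n + 1 + 1) ! : ℝ))
      ≤ (k ! * (Real.exp 2 * Real.exp 1 ^ n)) * ((R : ℝ) ^ n / n ! * (r : ℝ) ^ 2) := by gcongr
    _ = _ := by rw [mul_pow]; ring

end Poisson

/-! ### Laws of counts, Campbell's formula, and averaging of the charges. -/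

variable {d : ℕ} {Ω : Type*} [MeasurableSpace Ω] {P : Measure Ω} [IsProbabilityMeasure P]
  {lam : EuclideanSpace ℝ (Fin d) → ℝ} {τ : ℕ → Ω → EuclideanSpace ℝ (Fin d)}
  {A : ℕ → Ω → ℝ} {B : Set (EuclideanSpace ℝ (Fin d))}

omit [MeasurableSpace Ω] in
theorem pointMeasure_eq_hits (hB : MeasurableSet B) (ω : Ω) :
    pointMeasure τ ω B = hits B fun j => τ j ω := by
  simp [pointMeasure, hits, Measure.sum_apply _ hB, Measure.dirac_apply' _ hB]

namespace IsPoissonProcess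

omit [IsProbabilityMeasure P] in
theorem measurable_seq (hN : IsPoissonProcess P lam τ) : Measurable fun ω j => τ j ω :=
  measurable_pi_lambda _ hN.measurable

omit [IsProbabilityMeasure P] in
theorem measurable_hits_comp (hN : IsPoissonProcess P lam τ) (hB : MeasurableSet B) :
    Measurable fun ω => hits B fun j => τ j ω :=
  (measurable_hits hB).comp hN.measurable_seq

/-- The Poisson weights already sum to one, so no mass is left for infinite counts. Hence an
inequality on every measurable set, together with equal total mass, suffices. -/
theorem map_hits (hN : IsPoissonProcess P lam τ) (hB : MeasurableSet B)
    (hfin : intensityMeasure lam B ≠ ∞) :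
    P.map (fun ω => hits B fun j => τ j ω) =
      (poissonMeasure (intensityMeasure lam B).toNNReal).map (Nat.cast : ℕ → ℝ≥0∞) := by
  have hm := hN.measurable_hits_comp hB
  have hprob1 : IsProbabilityMeasure (P.map (fun ω => hits B fun j => τ j ω)) :=
    Measure.isProbabilityMeasure_map hm.aemeasurable
  have hc : Measurable (Nat.cast : ℕ → ℝ≥0∞) := measurable_from_top
  have hprob2 : IsProbabilityMeasure
      ((poissonMeasure (intensityMeasure lam B).toNNReal).map (Nat.cast : ℕ → ℝ≥0∞)) :=
    Measure.isProbabilityMeasure_map hc.aemeasurable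
  symm
  refine Measure.eq_of_le_of_measure_univ_eq (Measure.le_iff.mpr fun s hs => ?_) (by simp)
  rw [Measure.map_apply hc hs, Measure.map_apply hm hs]
  have hdis : Pairwise (Function.onFun Disjoint fun n : (Nat.cast : ℕ → ℝ≥0∞) ⁻¹' s =>
      {ω | hits B (fun j => τ j ω) = ((n : ℕ) : ℝ≥0∞)}) := by
    intro n n' hne
    refine Set.disjoint_left.mpr fun ω h1 h2 => hne ?_
    have h3 : ((n : ℕ) : ℝ≥0∞) = ((n' : ℕ) : ℝ≥0∞) := h1.symm.trans h2
    exact Subtype.ext (by exact_mod_cast h3)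
  have hmeas : ∀ n : (Nat.cast : ℕ → ℝ≥0∞) ⁻¹' s,
      MeasurableSet {ω | hits B (fun j => τ j ω) = ((n : ℕ) : ℝ≥0∞)} := fun n =>
    hm (measurableSet_singleton _)
  calc poissonMeasure (intensityMeasure lam B).toNNReal ((Nat.cast : ℕ → ℝ≥0∞) ⁻¹' s)
      = ∑' n : (Nat.cast : ℕ → ℝ≥0∞) ⁻¹' s,
        poissonMeasure (intensityMeasure lam B).toNNReal {(n : ℕ)} := by
        rw [← setLIntegral_one, lintegral_countable _ (Set.to_countable _)]
        simp
    _ = ∑' n : (Nat.cast : ℕ → ℝ≥0∞) ⁻¹' s,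
        P {ω | hits B (fun j => τ j ω) = ((n : ℕ) : ℝ≥0∞)} := by
        refine tsum_congr fun n => ?_
        have h := hN.poisson B hB hfin n
        simp only [pointMeasure_eq_hits hB] at h
        rw [h, poissonMeasure_singleton]
        rfl
    _ = P (⋃ n : (Nat.cast : ℕ → ℝ≥0∞) ⁻¹' s,
        {ω | hits B (fun j => τ j ω) = ((n : ℕ) : ℝ≥0∞)}) := (measure_iUnion hdis hmeas).symm
    _ ≤ _ := by
        refine measure_mono (Set.iUnion_subset fun n ω h => ?_)
        have h' : hits B (fun j => τ j ω) = ((n : ℕ) : ℝ≥0∞) := h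
        rw [Set.mem_preimage, h']
        exact n.2

theorem lintegral_hits (hN : IsPoissonProcess P lam τ) (hB : MeasurableSet B)
    (hfin : intensityMeasure lam B ≠ ∞) {H : ℝ≥0∞ → ℝ≥0∞} (hH : Measurable H) :
    ∫⁻ ω, H (hits B fun j => τ j ω) ∂P =
      ∫⁻ n : ℕ, H n ∂poissonMeasure (intensityMeasure lam B).toNNReal := by
  rw [← lintegral_map hH (hN.measurable_hits_comp hB), hN.map_hits hB hfin,
    lintegral_map hH measurable_from_top]

theorem lintegral_hits_self (hN : IsPoissonProcess P lam τ) (hB : MeasurableSet B)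
    (hfin : intensityMeasure lam B ≠ ∞) :
    ∫⁻ ω, hits B (fun j => τ j ω) ∂P = intensityMeasure lam B := by
  have h := hN.lintegral_hits hB hfin (H := fun n => n) measurable_id
  rw [h]
  simp only [lintegral_natCast_poissonMeasure, ENNReal.coe_toNNReal hfin]

theorem ae_hits_ne_top (hN : IsPoissonProcess P lam τ) (hB : MeasurableSet B)
    (hfin : intensityMeasure lam B ≠ ∞) : ∀ᵐ ω ∂P, hits B (fun j => τ j ω) ≠ ∞ := by
  have h := ae_lt_top (hN.measurable_hits_comp hB)
    (by rw [hN.lintegral_hits_self hB hfin]; exact hfin)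
  filter_upwards [h] with ω hω using hω.ne

/-- Campbell's formula. -/
theorem lintegral_tsum_comp (hN : IsPoissonProcess P lam τ) (hlam : Measurable lam)
    (hB : MeasurableSet B) (hfin : intensityMeasure lam B ≠ ∞)
    {f : EuclideanSpace ℝ (Fin d) → ℝ≥0∞} (hf : Measurable f) (hfB : ∀ y ∉ B, f y = 0) :
    ∫⁻ ω, ∑' j, f (τ j ω) ∂P = ∫⁻ y, f y * ENNReal.ofReal (lam y) := by
  -- The mean counts of subsets of `B` identify the mean measure of the process with `λ dy` on `B`,
  -- where the intensity is finite; Campbell's formula is then integration against the mean measure.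
  have hmeas : (Measure.sum fun j => P.map (τ j)).restrict B =
      ((volume : Measure (EuclideanSpace ℝ (Fin d))).withDensity
        fun y => ENNReal.ofReal (lam y)).restrict B := by
    refine Measure.ext fun s hs => ?_
    have hsB := hs.inter hB
    have hle : intensityMeasure lam (s ∩ B) ≤ intensityMeasure lam B :=
      lintegral_mono_set Set.inter_subset_right
    rw [Measure.restrict_apply hs, Measure.restrict_apply hs, withDensity_apply _ hsB,
      Measure.sum_apply _ hsB]
    have h1 := hN.lintegral_hits_self hsB (ne_top_of_le_ne_top hfin hle)
    rw [intensityMeasure] at h1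
    rw [← h1]
    simp only [hits]
    rw [lintegral_tsum]
    swap
    · exact fun j => ((measurable_one.indicator hsB).comp (hN.measurable j)).aemeasurable
    refine tsum_congr fun j => ?_
    rw [Measure.map_apply (hN.measurable j) hsB,
      ← lintegral_indicator_one (hN.measurable j hsB)]
    rfl
  have hind : B.indicator f = f := by
    rw [Set.indicator_eq_self]
    intro y hy
    by_contra h
    exact hy (hfB y h)
  calc ∫⁻ ω, ∑' j, f (τ j ω) ∂P = ∫⁻ y, f y ∂(Measure.sum fun j => P.map (τ j)) := by
        rw [lintegral_sum_measure, lintegral_tsum]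
        swap
        · exact fun j => (hf.comp (hN.measurable j)).aemeasurable
        exact tsum_congr fun j => (lintegral_map hf (hN.measurable j)).symm
    _ = ∫⁻ y in B, f y ∂(Measure.sum fun j => P.map (τ j)) := by
        rw [← lintegral_indicator hB, hind]
    _ = ∫⁻ y, f y ∂((volume : Measure (EuclideanSpace ℝ (Fin d))).withDensity
        fun y => ENNReal.ofReal (lam y)) := by
        rw [hmeas, ← lintegral_indicator hB, hind]
    _ = _ := by
        rw [lintegral_withDensity_eq_lintegral_mul _ hlam.ennreal_ofReal hf]
        simp only [Pi.mul_apply, mul_comm]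

end IsPoissonProcess

namespace IsCompoundPoisson

omit [IsProbabilityMeasure P] in
theorem measurable_marks (hY : IsCompoundPoisson P lam τ A) : Measurable fun ω j => A j ω :=
  measurable_pi_lambda _ hY.measurable

omit [IsProbabilityMeasure P] in
/-- The charges may be averaged out of a linear statistic, weighted by a function of the number
of points in `B`. -/
theorem lintegral_mul_tsum (hY : IsCompoundPoisson P lam τ A) (hB : MeasurableSet B)
    {H : ℝ≥0∞ → ℝ≥0∞} (hH : Measurable H) {h : ℝ → ℝ≥0∞} (hh : Measurable h)
    {f : EuclideanSpace ℝ (Fin d) → ℝ≥0∞} (hf : Measurable f) :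
    ∫⁻ ω, H (hits B fun j => τ j ω) * ∑' j, h (A j ω) * f (τ j ω) ∂P =
      (∫⁻ ω, h (A 0 ω) ∂P) *
        ∫⁻ ω, H (hits B fun j => τ j ω) * ∑' j, f (τ j ω) ∂P := by
  have hN := hY.points
  have hH' := hH.comp (hN.measurable_hits_comp hB)
  have hmf : ∀ j, Measurable fun ω => H (hits B fun i => τ i ω) * f (τ j ω) := fun j =>
    hH'.mul (hf.comp (hN.measurable j))
  have hterm : ∀ j, ∫⁻ ω, h (A j ω) * (H (hits B fun i => τ i ω) * f (τ j ω)) ∂P =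
      (∫⁻ ω, h (A 0 ω) ∂P) * ∫⁻ ω, H (hits B fun i => τ i ω) * f (τ j ω) ∂P := by
    intro j
    -- The second factor is a function of the point sequence alone, hence independent of `A j`.
    have hind : IndepFun (fun ω => h (A j ω))
        (fun ω => H (hits B fun i => τ i ω) * f (τ j ω)) P :=
      hY.indep_points.comp
        (show Measurable fun a : ℕ → ℝ => h (a j) from hh.comp (measurable_pi_apply j))
        (show Measurable fun x : ℕ → EuclideanSpace ℝ (Fin d) => H (hits B x) * f (x j) from
          (hH.comp (measurable_hits hB)).mul (hf.comp (measurable_pi_apply j)))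
    have h1 := lintegral_mul_eq_lintegral_mul_lintegral_of_indepFun
      (hh.comp (hY.measurable j)) (hmf j) hind
    simp only [Pi.mul_apply, Function.comp_apply] at h1
    rw [h1]
    congr 1
    exact ((hY.identDistrib j).comp hh).lintegral_eq
  simp only [← ENNReal.tsum_mul_left]
  rw [lintegral_tsum fun j => (hmf j).aemeasurable, lintegral_tsum, ← ENNReal.tsum_mul_left]
  · refine tsum_congr fun j => ?_
    rw [← hterm j]
    refine lintegral_congr fun ω => ?_
    ring
  · exact fun j => (hH'.mul ((hh.comp (hY.measurable j)).mul
      (hf.comp (hN.measurable j)))).aemeasurable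

end IsCompoundPoisson

end Scattering

/-! ### Exchangeable charges: moments depend only on counts. -/

namespace Scattering

section Permutation

variable {X U : Type*} [MeasureSpace U] {κ : X → U → ℂ} {ψ : U → ℂ} {p p' : ℝ}

theorem shotPower_comp_perm (σ : Equiv.Perm ℕ) {x x' : ℕ → X}
    (h : ∀ j u, κ (x' (σ j)) u = κ (x j) u) (a : ℕ → ℝ) :
    shotPower κ ψ p p' x' a = shotPower κ ψ p p' x fun j => a (σ j) := by
  have h1 : shotNoise κ x' a = shotNoise κ x fun j => a (σ j) := by
    funext u
    rw [shotNoise, shotNoise, ← σ.tsum_eq]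
    exact tsum_congr fun j => by rw [h]
  rw [shotPower, shotPower, shotTransform, shotTransform, h1]

/-- Two sequences with the same finite number of terms in each piece of a partition of `B`
agree, up to a permutation, as far as the pieces are concerned. -/
theorem exists_perm_of_hits_eq {Y : Type*} {B : Set X} {f : X → Y} {x x' : ℕ → X}
    (hx : hits B x ≠ ∞) (hx' : hits B x' ≠ ∞)
    (h : ∀ y, hits (B ∩ f ⁻¹' {y}) x = hits (B ∩ f ⁻¹' {y}) x') :
    ∃ σ : Equiv.Perm ℕ, ∀ j, (x' (σ j) ∈ B ↔ x j ∈ B) ∧ (x j ∈ B → f (x' (σ j)) = f (x j)) := by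
  classical
  let cell : X → Option Y := fun y => if y ∈ B then some (f y) else none
  have hsome : ∀ (z : ℕ → X) (y : Y), {j | cell (z j) = some y} = z ⁻¹' (B ∩ f ⁻¹' {y}) := by
    intro z y
    ext j
    by_cases hj : z j ∈ B <;> simp [cell, hj]
  have hnone : ∀ z : ℕ → X, {j | cell (z j) = none} = (z ⁻¹' B)ᶜ := by
    intro z
    ext j
    by_cases hj : z j ∈ B <;> simp [cell, hj]
  have hequiv : ∀ c : Option Y, Nonempty ({j // cell (x j) = c} ≃ {j // cell (x' j) = c}) := by
    rintro (_ | y)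
    -- Only finitely many terms lie in `B`, so the indices outside form countably infinite sets for
    -- both sequences and can be matched arbitrarily.
    · have i1 : Infinite {j // cell (x j) = none} := by
        have := (finite_of_hits_ne_top hx).infinite_compl
        rw [← hnone] at this
        exact this.to_subtype
      have i2 : Infinite {j // cell (x' j) = none} := by
        have := (finite_of_hits_ne_top hx').infinite_compl
        rw [← hnone] at this
        exact this.to_subtype
      exact nonempty_equiv_of_countable
    · have h1 := h y
      have hf1 : (x ⁻¹' (B ∩ f ⁻¹' {y})).Finite :=
        (finite_of_hits_ne_top hx).subset (Set.preimage_mono Set.inter_subset_left)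
      have hf2 : (x' ⁻¹' (B ∩ f ⁻¹' {y})).Finite :=
        (finite_of_hits_ne_top hx').subset (Set.preimage_mono Set.inter_subset_left)
      rw [hits_eq_card hf1, hits_eq_card hf2] at h1
      have hcard : hf1.toFinset.card = hf2.toFinset.card := by exact_mod_cast h1
      have e := Finset.equivOfCardEq hcard
      refine ⟨((Equiv.setCongr (hsome x y)).trans ?_).trans (Equiv.setCongr (hsome x' y)).symm⟩
      refine (Equiv.subtypeEquivRight fun j => ?_).trans
        (e.trans (Equiv.subtypeEquivRight fun j => ?_)) <;> simp
  refine ⟨Equiv.ofFiberEquiv fun c => (hequiv c).some, fun j => ?_⟩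
  have hj := Equiv.ofFiberEquiv_map (fun c => (hequiv c).some) j
  revert hj
  generalize x' (Equiv.ofFiberEquiv (fun c => (hequiv c).some) j) = z
  intro hj
  by_cases h1 : z ∈ B <;> by_cases h2 : x j ∈ B <;> simp_all [cell]

end Permutation

variable {d : ℕ} {Ω : Type*} [MeasurableSpace Ω] {P : Measure Ω} [IsProbabilityMeasure P]
  {lam : EuclideanSpace ℝ (Fin d) → ℝ} {τ τ' : ℕ → Ω → EuclideanSpace ℝ (Fin d)}
  {A : ℕ → Ω → ℝ} {B : Set (EuclideanSpace ℝ (Fin d))}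

/-- The joint law of the counts in disjoint sets is determined by the intensity. -/
theorem IsPoissonProcess.map_hits_eq (hN : IsPoissonProcess P lam τ)
    (hN' : IsPoissonProcess P lam τ') {m : ℕ} {C : Fin m → Set (EuclideanSpace ℝ (Fin d))}
    (hC : ∀ i, MeasurableSet (C i)) (hdis : ∀ i j, i ≠ j → Disjoint (C i) (C j))
    (hfin : ∀ i, intensityMeasure lam (C i) ≠ ∞) :
    P.map (fun ω i => hits (C i) fun j => τ j ω) =
      P.map (fun ω i => hits (C i) fun j => τ' j ω) := by
  have h1 := hN.indep m C hC hdis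
  have h2 := hN'.indep m C hC hdis
  simp only [pointMeasure_eq_hits (hC _)] at h1 h2
  rw [(iIndepFun_iff_map_fun_eq_pi_map
      fun i => (hN.measurable_hits_comp (hC i)).aemeasurable).mp h1,
    (iIndepFun_iff_map_fun_eq_pi_map
      fun i => (hN'.measurable_hits_comp (hC i)).aemeasurable).mp h2]
  congr 1
  funext i
  rw [hN.map_hits (hC i) (hfin i), hN'.map_hits (hC i) (hfin i)]

namespace IsCompoundPoisson

/-- The law of the charges is exchangeable. -/
theorem lintegral_marks_comp_perm (hY : IsCompoundPoisson P lam τ A) (σ : Equiv.Perm ℕ)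
    {F : (ℕ → ℝ) → ℝ≥0∞} (hF : Measurable F) :
    ∫⁻ a, F (fun j => a (σ j)) ∂P.map (fun ω j => A j ω) =
      ∫⁻ a, F a ∂P.map (fun ω j => A j ω) := by
  have hσ : Measurable fun ω j => A (σ j) ω := measurable_pi_lambda _ fun j => hY.measurable _
  have hmap : P.map (fun ω j => A (σ j) ω) = P.map (fun ω j => A j ω) := by
    rw [(iIndepFun_iff_map_fun_eq_infinitePi_map fun j => hY.measurable (σ j)).mp
        (hY.iIndep.precomp σ.injective),
      (iIndepFun_iff_map_fun_eq_infinitePi_map hY.measurable).mp hY.iIndep]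
    congr 1
    funext j
    rw [(hY.identDistrib (σ j)).map_eq, (hY.identDistrib j).map_eq]
  rw [← hmap, lintegral_map hF hσ, hmap, lintegral_map _ hY.measurable_marks]
  exact hF.comp (measurable_pi_lambda _ fun j => measurable_pi_apply (σ j))

theorem lintegral_eq_lintegral_lintegral (hY : IsCompoundPoisson P lam τ A)
    {F : (ℕ → EuclideanSpace ℝ (Fin d)) × (ℕ → ℝ) → ℝ≥0∞} (hF : Measurable F) :
    ∫⁻ ω, F (fun j => τ j ω, fun j => A j ω) ∂P =
      ∫⁻ ω, ∫⁻ a, F (fun j => τ j ω, a) ∂P.map (fun ω j => A j ω) ∂P := by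
  have hτ := hY.points.measurable_seq
  have hA := hY.measurable_marks
  have hprob : IsProbabilityMeasure (P.map fun ω j => A j ω) :=
    Measure.isProbabilityMeasure_map hA.aemeasurable
  have h := (indepFun_iff_map_prod_eq_prod_map_map hτ.aemeasurable hA.aemeasurable).mp
    hY.indep_points.symm
  rw [← lintegral_map hF (hτ.prodMk hA), h, lintegral_prod _ hF.aemeasurable,
    lintegral_map hF.lintegral_prod_right' hτ]

variable {U : Type*} [MeasureSpace U] [SFinite (volume : Measure U)]
  {κ : EuclideanSpace ℝ (Fin d) → U → ℂ} {ψ : U → ℂ} {p p' M : ℝ}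

/-- On `B` the kernel sees only the cell of `π` that contains a point. Two configurations with equal
cell counts differ by a relabelling, which exchangeable charges do not notice. The averaged value is
therefore a function of finitely many disjoint counts, whose joint law is fixed by `lam`. -/
theorem lintegral_shotPower_simpleFunc_eq (hY : IsCompoundPoisson P lam τ A)
    (hY' : IsCompoundPoisson P lam τ' A) (hB : MeasurableSet B)
    (hfin : intensityMeasure lam B ≠ ∞)
    (π : SimpleFunc (EuclideanSpace ℝ (Fin d)) (EuclideanSpace ℝ (Fin d)))
    (hκ : Measurable (Function.uncurry κ)) (hψ : Measurable ψ)
    (hκB : ∀ y ∉ B, ∀ u, κ y u = 0)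
    (hκπ : ∀ y ∈ B, ∀ z ∈ B, π y = π z → κ y = κ z) :
    ∫⁻ ω, shotPower κ ψ p p' (fun j => τ j ω) (fun j => A j ω) ∂P =
      ∫⁻ ω, shotPower κ ψ p p' (fun j => τ' j ω) (fun j => A j ω) ∂P := by
  classical
  have hF := measurable_shotPower hκ hψ p p'
  set μ := P.map fun ω j => A j ω with hμ
  set Ψ : (ℕ → EuclideanSpace ℝ (Fin d)) → ℝ≥0∞ :=
    fun x => ∫⁻ a, shotPower κ ψ p p' x a ∂μ with hΨ
  let C : Fin π.range.card → Set (EuclideanSpace ℝ (Fin d)) :=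
    fun i => B ∩ π ⁻¹' {((π.range.equivFin.symm i : π.range) : EuclideanSpace ℝ (Fin d))}
  have hC : ∀ i, MeasurableSet (C i) := fun i => hB.inter (π.measurableSet_preimage _)
  have hCdis : ∀ i j, i ≠ j → Disjoint (C i) (C j) := by
    intro i j hij
    refine Set.disjoint_left.mpr fun y h1 h2 => hij ?_
    apply π.range.equivFin.symm.injective
    exact Subtype.ext (h1.2.symm.trans h2.2)
  have hCfin : ∀ i, intensityMeasure lam (C i) ≠ ∞ := fun i =>
    ne_top_of_le_ne_top hfin (lintegral_mono_set Set.inter_subset_left)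
  have hinv : ∀ x x' : ℕ → EuclideanSpace ℝ (Fin d), hits B x ≠ ∞ → hits B x' ≠ ∞ →
      (∀ i, hits (C i) x = hits (C i) x') → Ψ x = Ψ x' := by
    intro x x' hx hx' h
    have h' : ∀ y, hits (B ∩ π ⁻¹' {y}) x = hits (B ∩ π ⁻¹' {y}) x' := by
      intro y
      by_cases hy : y ∈ π.range
      · have := h (π.range.equivFin ⟨y, hy⟩)
        simpa [C] using this
      · have he : π ⁻¹' {y} = ∅ := (SimpleFunc.preimage_eq_empty_iff π y).mpr
          (by simpa using hy)
        simp [he, hits]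
    obtain ⟨σ, hσ⟩ := exists_perm_of_hits_eq hx hx' h'
    have hσκ : ∀ j u, κ (x' (σ j)) u = κ (x j) u := by
      intro j u
      by_cases hj : x j ∈ B
      · rw [hκπ _ ((hσ j).1.mpr hj) _ hj ((hσ j).2 hj)]
      · rw [hκB _ hj, hκB _ fun h => hj ((hσ j).1.mp h)]
    have hFx : Measurable fun a => shotPower κ ψ p p' x a :=
      measurable_shotPower_right hκ hψ p p' x
    calc Ψ x = ∫⁻ a, shotPower κ ψ p p' x (fun j => a (σ j)) ∂μ :=
          (hY.lintegral_marks_comp_perm σ hFx).symm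
      _ = Ψ x' := lintegral_congr fun a => (shotPower_comp_perm σ hσκ a).symm
  -- A representative configuration is chosen for each realizable count vector. The domain is
  -- countable, so `γ` is measurable despite the choice; `0` is the value at vectors that no
  -- configuration realizes.
  let γ : (Fin π.range.card → ℕ) → ℝ≥0∞ := fun k =>
    if h : ∃ x : ℕ → EuclideanSpace ℝ (Fin d), hits B x ≠ ∞ ∧ ∀ i, hits (C i) x = k i
    then Ψ h.choose else 0
  let fl : (Fin π.range.card → ℝ≥0∞) → (Fin π.range.card → ℕ) := fun v i => ⌊(v i).toReal⌋₊
  have hfl : Measurable fl := measurable_pi_lambda _ fun i =>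
    Nat.measurable_floor.comp (measurable_pi_apply i).ennreal_toReal
  have hγfl : Measurable (γ ∘ fl) := (measurable_of_countable γ).comp hfl
  have hkey : ∀ x, hits B x ≠ ∞ → Ψ x = (γ ∘ fl) fun i => hits (C i) x := by
    intro x hx
    have hk : ∀ i, hits (C i) x = ((fl fun i => hits (C i) x) i : ℝ≥0∞) := by
      intro i
      have hf : (x ⁻¹' C i).Finite :=
        (finite_of_hits_ne_top hx).subset (Set.preimage_mono Set.inter_subset_left)
      simp [fl, hits_eq_card hf]
    have hex : ∃ x' : ℕ → EuclideanSpace ℝ (Fin d), hits B x' ≠ ∞ ∧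
        ∀ i, hits (C i) x' = ((fl fun i => hits (C i) x) i : ℝ≥0∞) := ⟨x, hx, hk⟩
    simp only [Function.comp_apply, γ, dif_pos hex]
    exact hinv _ _ hx hex.choose_spec.1 fun i => (hk i).trans (hex.choose_spec.2 i).symm
  have hstep : ∀ τ₀ : ℕ → Ω → EuclideanSpace ℝ (Fin d), IsCompoundPoisson P lam τ₀ A →
      ∫⁻ ω, shotPower κ ψ p p' (fun j => τ₀ j ω) (fun j => A j ω) ∂P =
        ∫⁻ v, (γ ∘ fl) v ∂P.map (fun ω i => hits (C i) fun j => τ₀ j ω) := by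
    intro τ₀ h₀
    rw [h₀.lintegral_eq_lintegral_lintegral (F := fun z => shotPower κ ψ p p' z.1 z.2) hF,
      lintegral_map hγfl (measurable_pi_lambda _ fun i => h₀.points.measurable_hits_comp (hC i))]
    refine lintegral_congr_ae ?_
    filter_upwards [h₀.points.ae_hits_ne_top hB hfin] with ω hω
    exact hkey _ hω
  rw [hstep τ hY, hstep τ' hY', hY.points.map_hits_eq hY'.points hC hCdis hCfin]

end IsCompoundPoisson

end Scattering

/-! ### Two-sided moment estimates and approximation of kernels. -/

namespace Scattering

section
variable {X U : Type*} [MeasureSpace U] {κ : X → U → ℂ} {ψ : U → ℂ} {p p' M : ℝ} {B : Set X}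

/-- Only finitely many points matter, so the fields converge pointwise; the power mean bound times
`‖ψ‖` dominates the integrands. -/
theorem tendsto_shotPower [MeasurableSpace X] (hp : 1 ≤ p) (hp' : 1 ≤ p') (hM0 : 0 ≤ M)
    {κn : ℕ → X → U → ℂ}
    (hκn : ∀ n, Measurable (Function.uncurry (κn n))) (hψ : Measurable ψ) (hψi : Integrable ψ)
    (hκnB : ∀ n, ∀ y ∉ B, ∀ u, κn n y u = 0) (hκB : ∀ y ∉ B, ∀ u, κ y u = 0)
    (hMn : ∀ n y u, ‖κn n y u‖ ≤ M)
    (hlim : ∀ y u, Tendsto (fun n => κn n y u) atTop (𝓝 (κ y u)))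
    {x : ℕ → X} (hx : hits B x ≠ ∞) (a : ℕ → ℝ) :
    Tendsto (fun n => shotPower (κn n) ψ p p' x a) atTop (𝓝 (shotPower κ ψ p p' x a)) := by
  have hf := finite_of_hits_ne_top hx
  have hs : ∀ j ∉ hf.toFinset, ∀ u, κ (x j) u = 0 := fun j hj => hκB _ (by simpa using hj)
  have hsn : ∀ n, ∀ j ∉ hf.toFinset, ∀ u, κn n (x j) u = 0 := fun n j hj =>
    hκnB n _ (by simpa using hj)
  have hnoise : ∀ u, Tendsto (fun n => shotNoise (κn n) x a u) atTop (𝓝 (shotNoise κ x a u)) := by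
    intro u
    simp only [shotNoise_eq_sum _ (hsn _), shotNoise_eq_sum _ hs]
    exact tendsto_finsetSum _ fun j _ => (hlim _ _).const_mul _
  have htrans : Tendsto (fun n => shotTransform (κn n) ψ p x a) atTop
      (𝓝 (shotTransform κ ψ p x a)) := by
    refine tendsto_integral_of_dominated_convergence
      (fun u => ((hf.toFinset.card : ℝ) ^ (p - 1) * (∑ j ∈ hf.toFinset, |a j| ^ p) * M ^ p) *
        ‖ψ u‖) (fun n => ?_) (hψi.norm.const_mul _) (fun n => ?_) ?_
    · have hpair : Measurable fun u : U => ((x, a), u) := by fun_prop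
      have h1 := (measurable_shotNoise (hκn n)).comp hpair
      have h2 : Measurable fun u => shotNoise (κn n) x a u := h1
      exact ((h2.norm.pow_const p).smul hψ).aestronglyMeasurable
    · refine Eventually.of_forall fun u => ?_
      rw [norm_smul, Real.norm_of_nonneg (by positivity)]
      exact mul_le_mul_of_nonneg_right
        (norm_shotNoise_rpow_le hp hM0 _ (hsn n) (hMn n) u) (norm_nonneg _)
    · refine Eventually.of_forall fun u => ?_
      exact ((hnoise u).norm.rpow_const (Or.inr (by linarith))).smul_const _
  exact (ENNReal.continuous_ofReal.tendsto _).comp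
    (htrans.norm.rpow_const (Or.inr (by linarith)))

end

variable {d : ℕ} {Ω : Type*} [MeasurableSpace Ω] {P : Measure Ω} [IsProbabilityMeasure P]
  {lam : EuclideanSpace ℝ (Fin d) → ℝ} {τ τ' : ℕ → Ω → EuclideanSpace ℝ (Fin d)}
  {A : ℕ → Ω → ℝ} {B : Set (EuclideanSpace ℝ (Fin d))}

/-- The contribution to the `k`-th moment of a Poisson variable of the values at least `2`. -/
noncomputable def multiplicityMoment (r : NNReal) (k : ℕ) : ℝ≥0∞ :=
  ∫⁻ n : ℕ, (if 2 ≤ n then (n : ℝ≥0∞) ^ k else 0) ∂poissonMeasure r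

theorem multiplicityMoment_ne_top (r : NNReal) (k : ℕ) : multiplicityMoment r k ≠ ∞ := by
  obtain ⟨C, hC, h⟩ := exists_lintegral_poissonMeasure_le r k
  exact ne_top_of_le_ne_top (ENNReal.mul_ne_top hC (by simp)) (h r le_rfl)

theorem measurable_multiplicity (m : ℕ) :
    Measurable fun v : ℝ≥0∞ => if 2 ≤ v then v ^ m else 0 :=
  Measurable.ite measurableSet_Ici (measurable_id.pow_const m) measurable_const

/-- Once the charges are averaged out, the remaining sum of indicators is again the count, which
raises the exponent from `m` to `m + 1`. -/
theorem IsCompoundPoisson.lintegral_multiplicity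
    (hY : IsCompoundPoisson P lam τ A) (hB : MeasurableSet B)
    (hfin : intensityMeasure lam B ≠ ∞) (m : ℕ) {h : ℝ → ℝ≥0∞} (hh : Measurable h) :
    ∫⁻ ω, (if 2 ≤ hits B (fun j => τ j ω) then hits B (fun j => τ j ω) ^ m else 0) *
        ∑' j, h (A j ω) * B.indicator 1 (τ j ω) ∂P =
      (∫⁻ ω, h (A 0 ω) ∂P) *
        multiplicityMoment (intensityMeasure lam B).toNNReal (m + 1) := by
  have h1 := hY.lintegral_mul_tsum hB (measurable_multiplicity m) hh (measurable_one.indicator hB)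
  rw [h1, multiplicityMoment]
  congr 1
  have h2 := hY.points.lintegral_hits hB hfin (measurable_multiplicity (m + 1))
  have h3 : ∀ n : ℕ, (2 : ℝ≥0∞) ≤ n ↔ 2 ≤ n := fun n => by norm_cast
  simp only [h3] at h2
  rw [← h2]
  refine lintegral_congr fun ω => ?_
  rw [show ∑' j, B.indicator (1 : EuclideanSpace ℝ (Fin d) → ℝ≥0∞) (τ j ω) = hits B fun j => τ j ω from rfl]
  split_ifs
  · rw [pow_succ]
  · rw [zero_mul]

namespace IsCompoundPoisson

variable {U : Type*} [MeasureSpace U] [SFinite (volume : Measure U)]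
  {κ : EuclideanSpace ℝ (Fin d) → U → ℂ} {ψ : U → ℂ} {p p' M : ℝ}

/-- `E ∑_j |A_j|^q f(τ_j) = E|A|^q ∫ f λ`. -/
theorem lintegral_tsum_mul (hY : IsCompoundPoisson P lam τ A) (hlam : Measurable lam)
    (hB : MeasurableSet B) (hfin : intensityMeasure lam B ≠ ∞) {h : ℝ → ℝ≥0∞} (hh : Measurable h)
    {f : EuclideanSpace ℝ (Fin d) → ℝ≥0∞} (hf : Measurable f) (hfB : ∀ y ∉ B, f y = 0) :
    ∫⁻ ω, ∑' j, h (A j ω) * f (τ j ω) ∂P =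
      (∫⁻ ω, h (A 0 ω) ∂P) * ∫⁻ y, f y * ENNReal.ofReal (lam y) := by
  have h1 := hY.lintegral_mul_tsum hB (H := fun _ => 1) measurable_const hh hf
  simp only [one_mul] at h1
  rw [h1, hY.points.lintegral_tsum_comp hlam hB hfin hf hfB]

variable (hY : IsCompoundPoisson P lam τ A) (hlam : Measurable lam) (hB : MeasurableSet B)
  (hfin : intensityMeasure lam B ≠ ∞) (hp : 1 ≤ p) (hp' : 1 ≤ p') (hM0 : 0 ≤ M)
  (hκ : Measurable (Function.uncurry κ)) (hψ : Measurable ψ) (hψi : Integrable ψ)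
  (hκB : ∀ y ∉ B, ∀ u, κ y u = 0) (hM : ∀ y u, ‖κ y u‖ ≤ M) {m : ℕ} (hm : p * p' - 1 ≤ m)

theorem two_le_hits_of_not_le_one {x : ℕ → EuclideanSpace ℝ (Fin d)} (hx : hits B x ≠ ∞)
    (h : ¬ hits B x ≤ 1) : 2 ≤ hits B x := by
  rw [hits_eq_card (finite_of_hits_ne_top hx)] at h ⊢
  have h1 : ¬ (finite_of_hits_ne_top hx).toFinset.card ≤ 1 := fun hc => h (by exact_mod_cast hc)
  have h2 : 2 ≤ (finite_of_hits_ne_top hx).toFinset.card := by omega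
  exact_mod_cast h2

include hY hlam hB hfin hp hp' hM0 hκ hψ hψi hκB hM hm

/-- Configurations with at most one point in `B` are treated exactly, all others by the crude bound.
-/
theorem lintegral_shotPower_le :
    ∫⁻ ω, shotPower κ ψ p p' (fun j => τ j ω) (fun j => A j ω) ∂P ≤
      (∫⁻ ω, ENNReal.ofReal (|A 0 ω| ^ (p * p')) ∂P) *
        (∫⁻ y, singlePower κ ψ p p' y * ENNReal.ofReal (lam y)) +
      ENNReal.ofReal ((M ^ p * ∫ u, ‖ψ u‖) ^ p') *
        ((∫⁻ ω, ENNReal.ofReal (|A 0 ω| ^ (p * p')) ∂P) *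
          multiplicityMoment (intensityMeasure lam B).toNNReal (m + 1)) := by
  have hh : Measurable fun a : ℝ => ENNReal.ofReal (|a| ^ (p * p')) := by fun_prop
  have hs0 : ∀ y ∉ B, singlePower κ ψ p p' y = 0 := fun y hy => by
    have := singlePower_le hp hp' hκB hM hψi y
    simpa [hy] using this
  rw [← hY.lintegral_tsum_mul hlam hB hfin hh (measurable_singlePower hκ hψ p p') hs0,
    ← hY.lintegral_multiplicity hB hfin m hh, ← lintegral_const_mul' _ _ ENNReal.ofReal_ne_top,
    ← lintegral_add_left]
  swap
  · exact Measurable.tsum fun j => (hh.comp (hY.measurable j)).mul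
      ((measurable_singlePower hκ hψ p p').comp (hY.points.measurable j))
  refine lintegral_mono_ae ?_
  filter_upwards [hY.points.ae_hits_ne_top hB hfin] with ω hω
  by_cases h : hits B (fun j => τ j ω) ≤ 1
  · rw [shotPower_of_hits_le_one hp hp' hκB h]
    exact le_self_add
  · rw [if_pos (two_le_hits_of_not_le_one hω h)]
    exact (shotPower_le hp hp' hM0 hκB hM hψi hω hm).trans le_add_self

omit hM0 hm in
-- The converse estimate: Campbell's sum also counts configurations with several points, but there
-- it obeys the same crude bound because the weight `hits ^ m` is at least one.
theorem lintegral_singlePower_le :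
    (∫⁻ ω, ENNReal.ofReal (|A 0 ω| ^ (p * p')) ∂P) *
        (∫⁻ y, singlePower κ ψ p p' y * ENNReal.ofReal (lam y)) ≤
      ∫⁻ ω, shotPower κ ψ p p' (fun j => τ j ω) (fun j => A j ω) ∂P +
      ENNReal.ofReal ((M ^ p * ∫ u, ‖ψ u‖) ^ p') *
        ((∫⁻ ω, ENNReal.ofReal (|A 0 ω| ^ (p * p')) ∂P) *
          multiplicityMoment (intensityMeasure lam B).toNNReal (m + 1)) := by
  have hh : Measurable fun a : ℝ => ENNReal.ofReal (|a| ^ (p * p')) := by fun_prop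
  have hs0 : ∀ y ∉ B, singlePower κ ψ p p' y = 0 := fun y hy => by
    have := singlePower_le hp hp' hκB hM hψi y
    simpa [hy] using this
  rw [← hY.lintegral_tsum_mul hlam hB hfin hh (measurable_singlePower hκ hψ p p') hs0,
    ← hY.lintegral_multiplicity hB hfin m hh, ← lintegral_const_mul' _ _ ENNReal.ofReal_ne_top,
    ← lintegral_add_left]
  swap
  · have h := (measurable_shotPower hκ hψ p p').comp
      (hY.points.measurable_seq.prodMk hY.measurable_marks)
    exact h
  refine lintegral_mono_ae ?_
  filter_upwards [hY.points.ae_hits_ne_top hB hfin] with ω hω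
  by_cases h : hits B (fun j => τ j ω) ≤ 1
  · rw [shotPower_of_hits_le_one hp hp' hκB h]
    exact le_self_add
  · have h2 := two_le_hits_of_not_le_one hω h
    rw [if_pos h2]
    refine le_trans ?_ le_add_self
    have h1 : 1 ≤ hits B (fun j => τ j ω) ^ m :=
      one_le_pow₀ (le_trans (by norm_num) h2)
    calc ∑' j, ENNReal.ofReal (|A j ω| ^ (p * p')) * singlePower κ ψ p p' (τ j ω)
        ≤ ∑' j, ENNReal.ofReal ((M ^ p * ∫ u, ‖ψ u‖) ^ p') *
          (ENNReal.ofReal (|A j ω| ^ (p * p')) * B.indicator 1 (τ j ω)) := by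
          refine ENNReal.tsum_le_tsum fun j => ?_
          rw [mul_left_comm]
          gcongr
          exact singlePower_le hp hp' hκB hM hψi _
      _ ≤ _ := by
          rw [ENNReal.tsum_mul_left]
          gcongr
          exact le_mul_of_one_le_left' h1

omit hp' hM0 hm hp hκ hψ hM hψi hκB hlam in
theorem lintegral_bound_ne_top (hA : ∫⁻ ω, ENNReal.ofReal (|A 0 ω| ^ (p * p')) ∂P ≠ ∞)
    (C : ℝ≥0∞) (hC : C ≠ ∞) :
    ∫⁻ ω, C * (hits B (fun j => τ j ω) ^ m *
      ∑' j, ENNReal.ofReal (|A j ω| ^ (p * p')) * B.indicator 1 (τ j ω)) ∂P ≠ ∞ := by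
  have hh : Measurable fun a : ℝ => ENNReal.ofReal (|a| ^ (p * p')) := by fun_prop
  rw [lintegral_const_mul' _ _ hC]
  refine ENNReal.mul_ne_top hC ?_
  rw [hY.lintegral_mul_tsum hB (H := fun v => v ^ m) (measurable_id.pow_const m) hh
    (measurable_one.indicator hB)]
  refine ENNReal.mul_ne_top hA ?_
  have h1 : ∀ ω, hits B (fun j => τ j ω) ^ m * ∑' j, B.indicator (1 : EuclideanSpace ℝ (Fin d) → ℝ≥0∞) (τ j ω) =
      hits B (fun j => τ j ω) ^ (m + 1) := fun ω => by
    rw [show ∑' j, B.indicator (1 : EuclideanSpace ℝ (Fin d) → ℝ≥0∞) (τ j ω) = hits B fun j => τ j ω from rfl, pow_succ]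
  simp only [h1]
  rw [hY.points.lintegral_hits hB hfin (H := fun v => v ^ (m + 1)) (measurable_id.pow_const _)]
  refine ne_top_of_le_ne_top (b := multiplicityMoment (intensityMeasure lam B).toNNReal (m + 1)
    + 1) (ENNReal.add_ne_top.mpr ⟨multiplicityMoment_ne_top _ _, ENNReal.one_ne_top⟩) ?_
  have h2 : (1 : ℝ≥0∞) = ∫⁻ _ : ℕ, 1 ∂poissonMeasure (intensityMeasure lam B).toNNReal := by simp
  conv_rhs => rw [h2]
  rw [multiplicityMoment, ← lintegral_add_right _ measurable_const]
  refine lintegral_mono fun n => ?_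
  by_cases hn : 2 ≤ n
  · simp [hn]
  · have : (n : ℝ≥0∞) ≤ 1 := by exact_mod_cast (by omega : n ≤ 1)
    simpa [hn] using pow_le_one₀ zero_le this

omit hlam hκ hM hκB in
theorem tendsto_lintegral_shotPower
    (hA : ∫⁻ ω, ENNReal.ofReal (|A 0 ω| ^ (p * p')) ∂P ≠ ∞)
    {κn : ℕ → EuclideanSpace ℝ (Fin d) → U → ℂ}
    (hκn : ∀ n, Measurable (Function.uncurry (κn n)))
    (hκnB : ∀ n, ∀ y ∉ B, ∀ u, κn n y u = 0) (hκB : ∀ y ∉ B, ∀ u, κ y u = 0)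
    (hMn : ∀ n y u, ‖κn n y u‖ ≤ M)
    (hlim : ∀ y u, Tendsto (fun n => κn n y u) atTop (𝓝 (κ y u))) :
    Tendsto (fun n => ∫⁻ ω, shotPower (κn n) ψ p p' (fun j => τ j ω) (fun j => A j ω) ∂P) atTop
      (𝓝 (∫⁻ ω, shotPower κ ψ p p' (fun j => τ j ω) (fun j => A j ω) ∂P)) := by
  refine tendsto_lintegral_of_dominated_convergence
    (fun ω => ENNReal.ofReal ((M ^ p * ∫ u, ‖ψ u‖) ^ p') * (hits B (fun j => τ j ω) ^ m *
      ∑' j, ENNReal.ofReal (|A j ω| ^ (p * p')) * B.indicator 1 (τ j ω))) (fun n => ?_)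
    (fun n => ?_) (hY.lintegral_bound_ne_top hB hfin hA _ ENNReal.ofReal_ne_top) ?_
  · have h := (measurable_shotPower (hκn n) hψ p p').comp
      (hY.points.measurable_seq.prodMk hY.measurable_marks)
    exact h
  · filter_upwards [hY.points.ae_hits_ne_top hB hfin] with ω hω
    exact shotPower_le hp hp' hM0 (hκnB n) (hMn n) hψi hω hm
  · filter_upwards [hY.points.ae_hits_ne_top hB hfin] with ω hω
    exact tendsto_shotPower hp hp' hM0 hκn hψ hψi hκnB hκB hMn hlim hω _

omit hlam hκ hκB hm hM in
/-- The moments depend on the points only through the intensity of the process. -/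
theorem lintegral_shotPower_eq (hY' : IsCompoundPoisson P lam τ' A)
    (hA : ∫⁻ ω, ENNReal.ofReal (|A 0 ω| ^ (p * p')) ∂P ≠ ∞)
    {G : EuclideanSpace ℝ (Fin d) → U → ℂ} (hG : Measurable (Function.uncurry G))
    (hGc : ∀ u, Continuous fun y => G y u) (hGM : ∀ y u, ‖G y u‖ ≤ M) :
    ∫⁻ ω, shotPower (B.indicator G) ψ p p' (fun j => τ j ω) (fun j => A j ω) ∂P =
      ∫⁻ ω, shotPower (B.indicator G) ψ p p' (fun j => τ' j ω) (fun j => A j ω) ∂P := by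
  classical
  -- The location entering `G` is discretized by simple functions tending to the identity. The
  -- cutoff to `B` stays exact, since its jump would spoil pointwise convergence; continuity is
  -- needed of `G` only.
  let π : ℕ → SimpleFunc (EuclideanSpace ℝ (Fin d)) (EuclideanSpace ℝ (Fin d)) := fun n =>
    SimpleFunc.approxOn id measurable_id Set.univ 0 (Set.mem_univ _) n
  have hπ : ∀ y, Tendsto (fun n => π n y) atTop (𝓝 y) := fun y =>
    SimpleFunc.tendsto_approxOn measurable_id (Set.mem_univ _) (by simp)
  let κn : ℕ → EuclideanSpace ℝ (Fin d) → U → ℂ := fun n => B.indicator fun y => G (π n y)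
  have hκn : ∀ n, Measurable (Function.uncurry (κn n)) := by
    intro n
    have h1 : Measurable fun z : EuclideanSpace ℝ (Fin d) × U => (π n z.1, z.2) :=
      ((π n).measurable.comp measurable_fst).prodMk measurable_snd
    have h2 := (hG.comp h1).indicator (measurable_fst hB)
    convert h2 using 1
    ext z
    by_cases hz : z.1 ∈ B <;> simp [κn, Function.uncurry, hz]
  have hκnB : ∀ n, ∀ y ∉ B, ∀ u, κn n y u = 0 := fun n y hy u => by simp [κn, hy]
  have hκB : ∀ y ∉ B, ∀ u, B.indicator G y u = 0 := fun y hy u => by simp [hy]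
  have hMn : ∀ n y u, ‖κn n y u‖ ≤ M := by
    intro n y u
    by_cases hy : y ∈ B
    · simpa [κn, hy] using hGM _ _
    · simpa [κn, hy] using hM0
  have hlim : ∀ y u, Tendsto (fun n => κn n y u) atTop (𝓝 (B.indicator G y u)) := by
    intro y u
    by_cases hy : y ∈ B
    · simpa [κn, hy, Function.comp_def] using ((hGc u).tendsto y).comp (hπ y)
    · simp [κn, hy]
  have hm := Nat.le_ceil (p * p' - 1)
  have t1 := hY.tendsto_lintegral_shotPower hB hfin hp hp' hM0 hψ hψi hm hA hκn hκnB hκB hMn hlim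
  have t2 := hY'.tendsto_lintegral_shotPower hB hfin hp hp' hM0 hψ hψi hm hA hκn hκnB hκB hMn hlim
  refine tendsto_nhds_unique t1 (t2.congr fun n => ?_)
  refine (hY.lintegral_shotPower_simpleFunc_eq hY' hB hfin (π n) (hκn n) hψ (hκnB n) ?_).symm
  intro y hy z hz hyz
  simp [κn, hy, hz, hyz]

end IsCompoundPoisson

end Scattering

/-! ### Boxes, Gabor filters and the rescaled envelope. -/

namespace Scattering

section Box
variable {d : ℕ}

theorem measurableSet_box {S : Set ℝ} (hS : MeasurableSet S) :
    MeasurableSet {t : EuclideanSpace ℝ (Fin d) | ∀ i, t i ∈ S} := by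
  rw [Set.ofPred_forall]
  exact MeasurableSet.iInter fun i => (by fun_prop : Measurable fun t : EuclideanSpace ℝ (Fin d) =>
    t i) hS

theorem volume_box {S : Set ℝ} (hS : MeasurableSet S) :
    volume {t : EuclideanSpace ℝ (Fin d) | ∀ i, t i ∈ S} = volume S ^ d := by
  have h : {t : EuclideanSpace ℝ (Fin d) | ∀ i, t i ∈ S} =
      WithLp.ofLp ⁻¹' Set.univ.pi fun _ : Fin d => S := by
    ext t; simp
  rw [h, (PiLp.volume_preserving_ofLp (Fin d)).measure_preimage
    (MeasurableSet.univ_pi fun _ => hS).nullMeasurableSet, volume_pi_pi]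
  simp

theorem cube_eq_box (a : ℝ) : cube d a = {t | ∀ i, t i ∈ Set.Icc 0 a} := rfl

theorem centredCube_eq_box (R : ℝ) : centredCube d R = {t | ∀ i, t i ∈ Set.Icc (-R) R} := by
  simp only [centredCube, abs_le, Set.mem_Icc]

theorem measurableSet_cube (a : ℝ) : MeasurableSet (cube d a) := measurableSet_box measurableSet_Icc

theorem volume_cube (a : ℝ) : volume (cube d a) = ENNReal.ofReal a ^ d := by
  rw [cube_eq_box, volume_box measurableSet_Icc, Real.volume_Icc, sub_zero]

theorem isCompact_cube (a : ℝ) : IsCompact (cube d a) := by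
  have h : cube d a = WithLp.toLp 2 '' Set.univ.pi fun _ : Fin d => Set.Icc 0 a := by
    ext t
    constructor
    · intro ht
      exact ⟨WithLp.ofLp t, fun i _ => ht i, rfl⟩
    · rintro ⟨x, hx, rfl⟩
      exact fun i => hx i (Set.mem_univ i)
  rw [h]
  exact (isCompact_univ_pi fun _ => isCompact_Icc).image (PiLp.continuous_toLp 2 _)

theorem add_mem_cube {a b : ℝ} {x y : EuclideanSpace ℝ (Fin d)} (hx : x ∈ cube d a)
    (hy : y ∈ cube d b) : x + y ∈ cube d (a + b) := fun i =>
  ⟨add_nonneg (hx i).1 (hy i).1, add_le_add (hx i).2 (hy i).2⟩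

theorem smul_mem_cube {a s : ℝ} (hs : 0 ≤ s) {x : EuclideanSpace ℝ (Fin d)} (hx : x ∈ cube d a) :
    s • x ∈ cube d (s * a) := fun i =>
  ⟨mul_nonneg hs (hx i).1, mul_le_mul_of_nonneg_left (hx i).2 hs⟩

end Box

section Gabor
variable {d : ℕ} {w : EuclideanSpace ℝ (Fin d) → ℂ}

theorem norm_gabor (w : EuclideanSpace ℝ (Fin d) → ℂ) (s : ℝ) (ξ t : EuclideanSpace ℝ (Fin d)) :
    ‖gabor w s ξ t‖ = ‖w (s⁻¹ • t)‖ := by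
  rw [gabor, norm_mul, mul_comm Complex.I, Complex.norm_exp_ofReal_mul_I, mul_one]

theorem continuous_gabor (hw : Continuous w) (s : ℝ) (ξ : EuclideanSpace ℝ (Fin d)) :
    Continuous (gabor w s ξ) := by
  unfold gabor
  fun_prop

theorem gabor_eq_zero (hw : Function.support w ⊆ cube d 1) {s : ℝ} (hs : 0 < s)
    (ξ : EuclideanSpace ℝ (Fin d)) {t : EuclideanSpace ℝ (Fin d)} (ht : t ∉ cube d s) :
    gabor w s ξ t = 0 := by
  rw [← norm_eq_zero, norm_gabor, norm_eq_zero]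
  by_contra h
  have h1 := smul_mem_cube hs.le (hw h)
  rw [smul_inv_smul₀ hs.ne', mul_one] at h1
  exact ht h1

theorem hasCompactSupport_gabor (hw : Function.support w ⊆ cube d 1) {s : ℝ} (hs : 0 < s)
    (ξ : EuclideanSpace ℝ (Fin d)) : HasCompactSupport (gabor w s ξ) :=
  HasCompactSupport.intro (isCompact_cube s) fun _ ht => gabor_eq_zero hw hs ξ ht

theorem exists_norm_le (hw : Continuous w) (hsupp : Function.support w ⊆ cube d 1) :
    ∃ M : ℝ, 0 ≤ M ∧ ∀ t, ‖w t‖ ≤ M := by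
  have hc : HasCompactSupport w := HasCompactSupport.intro (isCompact_cube 1) fun t ht => by
    by_contra h
    exact ht (hsupp h)
  obtain ⟨M, hM⟩ := hc.exists_bound_of_continuous hw
  exact ⟨M, (norm_nonneg _).trans (hM 0), hM⟩

/-- The filtered envelope `|g_{s, ξ}|^p * g_{s', ξ'}`, which does not depend on `ξ`. -/
noncomputable def envelope (w : EuclideanSpace ℝ (Fin d) → ℂ) (p s s' : ℝ)
    (ξ' : EuclideanSpace ℝ (Fin d)) : EuclideanSpace ℝ (Fin d) → ℂ :=
  (fun u => ‖gabor w s 0 u‖ ^ p) ⋆ gabor w s' ξ'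

theorem envelope_apply (w : EuclideanSpace ℝ (Fin d) → ℂ) (p s s' : ℝ)
    (ξ' z : EuclideanSpace ℝ (Fin d)) :
    envelope w p s s' ξ' z = ∫ u, (‖w (s⁻¹ • u)‖ ^ p) • gabor w s' ξ' (z - u) := by
  rw [envelope, convolution_def]
  simp only [norm_gabor]
  rfl

theorem continuous_norm_gabor_rpow (hw : Continuous w) {p : ℝ} (hp : 1 ≤ p) (s : ℝ)
    (ξ : EuclideanSpace ℝ (Fin d)) : Continuous fun u => ‖gabor w s ξ u‖ ^ p :=
  (continuous_gabor hw s ξ).norm.rpow_const fun _ => Or.inr (by linarith)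

theorem hasCompactSupport_norm_gabor_rpow (hsupp : Function.support w ⊆ cube d 1) {p : ℝ}
    (hp : 1 ≤ p) {s : ℝ} (hs : 0 < s) (ξ : EuclideanSpace ℝ (Fin d)) :
    HasCompactSupport fun u => ‖gabor w s ξ u‖ ^ p :=
  (hasCompactSupport_gabor hsupp hs ξ).comp_left (g := fun z => ‖z‖ ^ p)
    (by simp [Real.zero_rpow (by linarith : p ≠ 0)])

theorem continuous_envelope (hw : Continuous w) (hsupp : Function.support w ⊆ cube d 1) {p : ℝ}
    (hp : 1 ≤ p) {s' : ℝ} (s : ℝ) (hs' : 0 < s') (ξ' : EuclideanSpace ℝ (Fin d)) :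
    Continuous (envelope w p s s' ξ') :=
  (hasCompactSupport_gabor hsupp hs' ξ').continuous_convolution_right _
    (continuous_norm_gabor_rpow hw hp s 0).locallyIntegrable (continuous_gabor hw s' ξ')

theorem hasCompactSupport_envelope (hsupp : Function.support w ⊆ cube d 1) {p : ℝ}
    (hp : 1 ≤ p) {s s' : ℝ} (hs : 0 < s) (hs' : 0 < s') (ξ' : EuclideanSpace ℝ (Fin d)) :
    HasCompactSupport (envelope w p s s' ξ') :=
  HasCompactSupport.convolution _ (hasCompactSupport_norm_gabor_rpow hsupp hp hs 0)
    (hasCompactSupport_gabor hsupp hs' ξ')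

/-- The modulus of the envelope is controlled uniformly in the frequency. -/
noncomputable def envelopeBound (w : EuclideanSpace ℝ (Fin d) → ℂ) (p c : ℝ) :
    EuclideanSpace ℝ (Fin d) → ℝ :=
  (fun u => ‖gabor w 1 0 u‖ ^ p) ⋆ fun u => ‖gabor w c 0 u‖

theorem envelopeBound_apply (w : EuclideanSpace ℝ (Fin d) → ℂ) (p c : ℝ)
    (z : EuclideanSpace ℝ (Fin d)) :
    envelopeBound w p c z = ∫ u, ‖w u‖ ^ p * ‖w (c⁻¹ • (z - u))‖ := by
  rw [envelopeBound, convolution_def]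
  simp only [norm_gabor, inv_one, one_smul]
  rfl

theorem continuous_envelopeBound (hw : Continuous w) (hsupp : Function.support w ⊆ cube d 1)
    {p : ℝ} (hp : 1 ≤ p) {c : ℝ} (hc : 0 < c) : Continuous (envelopeBound w p c) :=
  (hasCompactSupport_gabor hsupp hc 0).norm.continuous_convolution_right _
    (continuous_norm_gabor_rpow hw hp 1 0).locallyIntegrable (continuous_gabor hw c 0).norm

theorem hasCompactSupport_envelopeBound (hsupp : Function.support w ⊆ cube d 1) {p : ℝ}
    (hp : 1 ≤ p) {c : ℝ} (hc : 0 < c) : HasCompactSupport (envelopeBound w p c) :=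
  HasCompactSupport.convolution _ (hasCompactSupport_norm_gabor_rpow hsupp hp one_pos 0)
    (hasCompactSupport_gabor hsupp hc 0).norm

theorem norm_envelope_le (w : EuclideanSpace ℝ (Fin d) → ℂ) (p c : ℝ)
    (η z : EuclideanSpace ℝ (Fin d)) : ‖envelope w p 1 c η z‖ ≤ envelopeBound w p c z := by
  rw [envelope_apply, envelopeBound_apply]
  refine (norm_integral_le_integral_norm _).trans (le_of_eq ?_)
  refine integral_congr_ae (Eventually.of_forall fun u => ?_)
  simp only [norm_smul, norm_gabor, inv_one, one_smul]
  rw [Real.norm_of_nonneg (by positivity)]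

/-- Substituting `u = s v` produces the Jacobian `s ^ d` and moves the scale into the frequency, by
`ξ' · (s z) = (s ξ') · z`. -/
theorem envelope_smul (w : EuclideanSpace ℝ (Fin d) → ℂ) (p c : ℝ) {s : ℝ} (hs : 0 < s)
    (ξ' z : EuclideanSpace ℝ (Fin d)) :
    envelope w p s (c * s) ξ' (s • z) = (s ^ d : ℝ) • envelope w p 1 c (s • ξ') z := by
  rw [envelope_apply, envelope_apply]
  have h := Measure.integral_comp_smul (volume : Measure (EuclideanSpace ℝ (Fin d)))
    (fun u => (‖w (s⁻¹ • u)‖ ^ p) • gabor w (c * s) ξ' (s • z - u)) s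
  rw [finrank_euclideanSpace_fin, abs_of_pos (by positivity)] at h
  have h2 : ∀ v, (‖w (s⁻¹ • s • v)‖ ^ p) • gabor w (c * s) ξ' (s • z - s • v) =
      (‖w ((1 : ℝ)⁻¹ • v)‖ ^ p) • gabor w c (s • ξ') (z - v) := by
    intro v
    rw [inv_smul_smul₀ hs.ne', inv_one, one_smul, ← smul_sub, gabor, gabor, smul_smul,
      real_inner_smul_right, real_inner_smul_left, mul_inv, mul_assoc, inv_mul_cancel₀ hs.ne',
      mul_one]
  simp only [h2] at h
  rw [h, smul_smul, mul_inv_cancel₀ (by positivity), one_smul]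

/-- The limit profile of the second-order moments. -/
noncomputable def profile (w : EuclideanSpace ℝ (Fin d) → ℂ) (lam : EuclideanSpace ℝ (Fin d) → ℝ)
    (p p' c s : ℝ) (η t : EuclideanSpace ℝ (Fin d)) : ℝ :=
  ∫ z, ‖envelope w p 1 c η z‖ ^ p' * lam (t - s • z)

theorem integrable_envelopeBound_rpow (hw : Continuous w) (hsupp : Function.support w ⊆ cube d 1)
    {p p' c : ℝ} (hp : 1 ≤ p) (hp' : 1 ≤ p') (hc : 0 < c) :
    Integrable fun z => envelopeBound w p c z ^ p' :=
  ((continuous_envelopeBound hw hsupp hp hc).rpow_const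
    fun _ => Or.inr (by linarith)).integrable_of_hasCompactSupport
    ((hasCompactSupport_envelopeBound hsupp hp hc).comp_left (g := fun z => z ^ p')
      (by simp [Real.zero_rpow (by linarith : p' ≠ 0)]))

theorem norm_profile_integrand_le {lam : EuclideanSpace ℝ (Fin d) → ℝ} {b : ℝ}
    (hlam0 : ∀ t, 0 ≤ lam t) (hb : ∀ t, lam t ≤ b) {p p' : ℝ} (hp' : 1 ≤ p') (c s : ℝ)
    (η t z : EuclideanSpace ℝ (Fin d)) :
    ‖‖envelope w p 1 c η z‖ ^ p' * lam (t - s • z)‖ ≤ envelopeBound w p c z ^ p' * b := by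
  rw [Real.norm_of_nonneg (mul_nonneg (by positivity) (hlam0 _))]
  have h := norm_envelope_le w p c η z
  have h0 := (norm_nonneg _).trans h
  exact mul_le_mul (Real.rpow_le_rpow (norm_nonneg _) h (by linarith)) (hb _) (hlam0 _)
    (by positivity)

/-- The bound is uniform in scale, frequency and location, as needed to dominate the integrals over
a period. -/
theorem abs_profile_le (hw : Continuous w) (hsupp : Function.support w ⊆ cube d 1)
    {lam : EuclideanSpace ℝ (Fin d) → ℝ} {b : ℝ} (hlam0 : ∀ t, 0 ≤ lam t) (hb : ∀ t, lam t ≤ b)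
    {p p' c : ℝ} (hp : 1 ≤ p) (hp' : 1 ≤ p') (hc : 0 < c) (s : ℝ)
    (η t : EuclideanSpace ℝ (Fin d)) :
    |profile w lam p p' c s η t| ≤ ∫ z, envelopeBound w p c z ^ p' * b :=
  norm_integral_le_of_norm_le ((integrable_envelopeBound_rpow hw hsupp hp hp' hc).mul_const b)
    (Eventually.of_forall fun z => norm_profile_integrand_le hlam0 hb hp' c s η t z)

theorem tendsto_envelope (hw : Continuous w) (hsupp : Function.support w ⊆ cube d 1)
    {p c : ℝ} (hp : 1 ≤ p) {η : ℕ → EuclideanSpace ℝ (Fin d)}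
    {η₀ : EuclideanSpace ℝ (Fin d)} (hη : Tendsto η atTop (𝓝 η₀))
    (z : EuclideanSpace ℝ (Fin d)) :
    Tendsto (fun k => envelope w p 1 c (η k) z) atTop (𝓝 (envelope w p 1 c η₀ z)) := by
  obtain ⟨M, hM0, hM⟩ := exists_norm_le hw hsupp
  simp only [envelope_apply]
  have hcont := continuous_norm_gabor_rpow hw hp 1 0
  simp only [norm_gabor] at hcont
  have hint : Integrable fun u => ‖w ((1 : ℝ)⁻¹ • u)‖ ^ p := by
    have := hcont.integrable_of_hasCompactSupport (μ := volume)
      (by simpa only [norm_gabor] using hasCompactSupport_norm_gabor_rpow hsupp hp one_pos 0)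
    exact this
  refine tendsto_integral_of_dominated_convergence
    (fun u => ‖w ((1 : ℝ)⁻¹ • u)‖ ^ p * M) (fun k => ?_) (hint.mul_const M) (fun k => ?_) ?_
  · exact (hcont.smul ((continuous_gabor hw c (η k)).comp
      (continuous_const.sub continuous_id))).aestronglyMeasurable
  · refine Eventually.of_forall fun u => ?_
    rw [norm_smul, Real.norm_of_nonneg (by positivity), norm_gabor]
    gcongr
    exact hM _
  · refine Eventually.of_forall fun u => Tendsto.const_smul ?_ _
    have hg : Continuous fun ξ : EuclideanSpace ℝ (Fin d) => gabor w c ξ (z - u) := by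
      unfold gabor
      fun_prop
    exact (hg.tendsto η₀).comp hη

/-- `envelopeBound` does not see the frequency, so one integrable function dominates the whole
sequence. -/
theorem tendsto_profile (hw : Continuous w) (hsupp : Function.support w ⊆ cube d 1)
    {lam : EuclideanSpace ℝ (Fin d) → ℝ} (hlam : Continuous lam) {b : ℝ}
    (hlam0 : ∀ t, 0 ≤ lam t) (hb : ∀ t, lam t ≤ b)
    {p p' c : ℝ} (hp : 1 ≤ p) (hp' : 1 ≤ p') (hc : 0 < c) {s : ℕ → ℝ}
    (hs : Tendsto s atTop (𝓝 0)) {η : ℕ → EuclideanSpace ℝ (Fin d)}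
    {η₀ : EuclideanSpace ℝ (Fin d)} (hη : Tendsto η atTop (𝓝 η₀))
    (t : EuclideanSpace ℝ (Fin d)) :
    Tendsto (fun k => profile w lam p p' c (s k) (η k) t) atTop
      (𝓝 ((∫ z, ‖envelope w p 1 c η₀ z‖ ^ p') * lam t)) := by
  rw [← integral_mul_const]
  refine tendsto_integral_of_dominated_convergence (fun z => envelopeBound w p c z ^ p' * b)
    (fun k => ?_) ((integrable_envelopeBound_rpow hw hsupp hp hp' hc).mul_const b)
    (fun k => Eventually.of_forall fun z => norm_profile_integrand_le hlam0 hb hp' c _ _ t z) ?_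
  · exact (((continuous_envelope hw hsupp hp 1 hc (η k)).norm.rpow_const
      fun _ => Or.inr (by linarith)).mul (hlam.comp (by fun_prop))).aestronglyMeasurable
  · refine Eventually.of_forall fun z => Tendsto.mul ?_ ?_
    · exact (tendsto_envelope hw hsupp hp hη z).norm.rpow_const (Or.inr (by linarith))
    · have h : Tendsto (fun k => t - s k • z) atTop (𝓝 t) := by
        simpa using tendsto_const_nhds.sub (hs.smul_const z)
      exact (hlam.tendsto t).comp h

theorem constK_eq (hw : Continuous w) (hsupp : Function.support w ⊆ cube d 1)
    {p p' c : ℝ} (hp : 1 ≤ p) (hp' : 1 ≤ p') (hc : 0 < c) (L : EuclideanSpace ℝ (Fin d)) :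
    constK w p p' c L = ∫ z, ‖envelope w p 1 c (c⁻¹ • L) z‖ ^ p' := by
  have hmem : MemLp (envelope w p 1 c (c⁻¹ • L)) (ENNReal.ofReal p') volume :=
    (continuous_envelope hw hsupp hp 1 hc _).memLp_of_hasCompactSupport
      (hasCompactSupport_envelope hsupp hp one_pos hc _)
  have h := hmem.eLpNorm_eq_integral_rpow_norm (by simp; linarith) ENNReal.ofReal_ne_top
  rw [ENNReal.toReal_ofReal (by linarith)] at h
  have h0 : 0 ≤ ∫ z, ‖envelope w p 1 c (c⁻¹ • L) z‖ ^ p' :=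
    integral_nonneg fun z => by positivity
  rw [constK]
  change (eLpNorm (envelope w p 1 c (c⁻¹ • L)) _ _).toReal ^ p' = _
  rw [h, ENNReal.toReal_ofReal (by positivity), ← Real.rpow_mul h0,
    inv_mul_cancel₀ (by linarith), Real.rpow_one]

end Gabor

end Scattering

/-! ### Reduction to a window around `t`. -/

namespace Scattering

section Window
variable {d : ℕ} {w : EuclideanSpace ℝ (Fin d) → ℂ}

/-- The locations of the points that can influence a response at `t`. -/
def window (t : EuclideanSpace ℝ (Fin d)) (a : ℝ) : Set (EuclideanSpace ℝ (Fin d)) :=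
  {x | t - x ∈ cube d a}

theorem measurableSet_window (t : EuclideanSpace ℝ (Fin d)) (a : ℝ) :
    MeasurableSet (window t a) :=
  (by fun_prop : Measurable fun x : EuclideanSpace ℝ (Fin d) => t - x) (measurableSet_cube a)

theorem volume_window (t : EuclideanSpace ℝ (Fin d)) (a : ℝ) :
    volume (window t a) = ENNReal.ofReal a ^ d := by
  have h : MeasurePreserving (fun x : EuclideanSpace ℝ (Fin d) => t - x) volume volume :=
    Measure.measurePreserving_sub_left volume t
  rw [← volume_cube, ← h.measure_preimage (measurableSet_cube a).nullMeasurableSet]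
  rfl

theorem intensityMeasure_window_le {lam : EuclideanSpace ℝ (Fin d) → ℝ} {b : ℝ}
    (hb : ∀ t, lam t ≤ b) (t : EuclideanSpace ℝ (Fin d)) (a : ℝ) :
    intensityMeasure lam (window t a) ≤ ENNReal.ofReal b * ENNReal.ofReal a ^ d := by
  rw [← volume_window t a, ← setLIntegral_const]
  exact lintegral_mono fun x => ENNReal.ofReal_le_ofReal (hb x)

theorem intensityMeasure_window_ne_top {lam : EuclideanSpace ℝ (Fin d) → ℝ} {b : ℝ}
    (hb : ∀ t, lam t ≤ b) (t : EuclideanSpace ℝ (Fin d)) (a : ℝ) :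
    intensityMeasure lam (window t a) ≠ ∞ :=
  ne_top_of_le_ne_top (ENNReal.mul_ne_top ENNReal.ofReal_ne_top (by simp))
    (intensityMeasure_window_le hb t a)

/-- The translates of `g`, as a kernel. -/
def translates (g : EuclideanSpace ℝ (Fin d) → ℂ) (x u : EuclideanSpace ℝ (Fin d)) : ℂ :=
  g (u - x)

/-- If the second filter is nonzero at `t - u`, then `t - u ∈ [0, s']^d`; a nonzero first filter
gives `u - x ∈ [0, s]^d`. The sum `t - x` then lies in `[0, s + s']^d`, so truncating the kernel
changes nothing that the second filter sees. -/
theorem indicator_translates_eq (hsupp : Function.support w ⊆ cube d 1) {s s' : ℝ} (hs : 0 < s)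
    (hs' : 0 < s') {ξ ξ' t x u : EuclideanSpace ℝ (Fin d)} (hu : gabor w s' ξ' (t - u) ≠ 0) :
    (window t (s + s')).indicator (translates (gabor w s ξ)) x u = gabor w s ξ (u - x) := by
  by_cases hx : x ∈ window t (s + s')
  · rw [Set.indicator_of_mem hx, translates]
  · rw [Set.indicator_of_notMem hx, Pi.zero_apply]
    symm
    refine gabor_eq_zero hsupp hs ξ fun h => hx ?_
    have h1 : t - u ∈ cube d s' := by
      by_contra hc
      exact hu (gabor_eq_zero hsupp hs' ξ' hc)
    have h2 := add_mem_cube h1 h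
    rwa [sub_add_sub_cancel, add_comm s' s] at h2

theorem secondResponse_eq {Ω : Type*} (hsupp : Function.support w ⊆ cube d 1) {s s' : ℝ}
    (hs : 0 < s) (hs' : 0 < s') (ξ ξ' : EuclideanSpace ℝ (Fin d)) (p : ℝ)
    (τ : ℕ → Ω → EuclideanSpace ℝ (Fin d)) (A : ℕ → Ω → ℝ) (ω : Ω)
    (t : EuclideanSpace ℝ (Fin d)) :
    secondResponse τ A (gabor w s ξ) p (gabor w s' ξ') ω t =
      shotTransform ((window t (s + s')).indicator (translates (gabor w s ξ)))
        (fun u => gabor w s' ξ' (t - u)) p (fun j => τ j ω) (fun j => A j ω) := by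
  rw [secondResponse, convolution_def, shotTransform]
  refine integral_congr_ae (Eventually.of_forall fun u => ?_)
  change (‖response τ A (gabor w s ξ) ω u‖ ^ p) • gabor w s' ξ' (t - u) = _
  by_cases hu : gabor w s' ξ' (t - u) = 0
  · simp [hu]
  · simp only [response, shotNoise, indicator_translates_eq hsupp hs hs' hu]

theorem singlePower_eq (hsupp : Function.support w ⊆ cube d 1) {s s' : ℝ}
    (hs : 0 < s) (hs' : 0 < s') (ξ ξ' : EuclideanSpace ℝ (Fin d)) (p p' : ℝ)
    (t x : EuclideanSpace ℝ (Fin d)) :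
    singlePower ((window t (s + s')).indicator (translates (gabor w s ξ)))
        (fun u => gabor w s' ξ' (t - u)) p p' x =
      ENNReal.ofReal (‖envelope w p s s' ξ' (t - x)‖ ^ p') := by
  rw [singlePower, envelope_apply,
    ← integral_sub_right_eq_self (fun u => (‖w (s⁻¹ • u)‖ ^ p) • gabor w s' ξ' (t - x - u)) x]
  congr 3
  refine integral_congr_ae (Eventually.of_forall fun u => ?_)
  simp only [sub_sub, add_sub_cancel]
  by_cases hu : gabor w s' ξ' (t - u) = 0
  · simp [hu]
  · simp only [indicator_translates_eq hsupp hs hs' hu, norm_gabor]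

theorem measurable_indicator_translates (hw : Continuous w) (s a : ℝ)
    (ξ t : EuclideanSpace ℝ (Fin d)) :
    Measurable (Function.uncurry ((window t a).indicator (translates (gabor w s ξ)))) := by
  have h1 : Continuous fun z : EuclideanSpace ℝ (Fin d) × EuclideanSpace ℝ (Fin d) =>
      gabor w s ξ (z.2 - z.1) := (continuous_gabor hw s ξ).comp (by fun_prop)
  have h2 := h1.measurable.indicator (measurable_fst (measurableSet_window t a))
  convert h2 using 1
  ext z
  by_cases hz : z.1 ∈ window t a <;> simp [Function.uncurry, hz, translates]

theorem norm_indicator_translates_le {M : ℝ} (hM0 : 0 ≤ M) (hM : ∀ t, ‖w t‖ ≤ M) (s a : ℝ)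
    (ξ t x u : EuclideanSpace ℝ (Fin d)) :
    ‖(window t a).indicator (translates (gabor w s ξ)) x u‖ ≤ M := by
  by_cases hx : x ∈ window t a
  · rw [Set.indicator_of_mem hx, translates, norm_gabor]
    exact hM _
  · simpa [hx] using hM0

theorem indicator_translates_eq_zero (s a : ℝ) (ξ t : EuclideanSpace ℝ (Fin d)) :
    ∀ x ∉ window t a, ∀ u, (window t a).indicator (translates (gabor w s ξ)) x u = 0 :=
  fun x hx u => by simp [hx]

theorem integrable_gabor_sub (hw : Continuous w) (hsupp : Function.support w ⊆ cube d 1) {s : ℝ}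
    (hs : 0 < s) (ξ t : EuclideanSpace ℝ (Fin d)) : Integrable fun u => gabor w s ξ (t - u) :=
  ((continuous_gabor hw s ξ).integrable_of_hasCompactSupport
    (hasCompactSupport_gabor hsupp hs ξ)).comp_sub_left t

theorem integral_norm_gabor_sub (w : EuclideanSpace ℝ (Fin d) → ℂ) {s : ℝ} (hs : 0 < s)
    (ξ t : EuclideanSpace ℝ (Fin d)) :
    ∫ u, ‖gabor w s ξ (t - u)‖ = s ^ d * ∫ u, ‖w u‖ := by
  rw [integral_sub_left_eq_self (fun u => ‖gabor w s ξ u‖) volume t]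
  simp only [norm_gabor]
  rw [Measure.integral_comp_smul volume (fun u => ‖w u‖), finrank_euclideanSpace_fin]
  simp [abs_of_pos (pow_pos hs d)]

/-- The envelope contributes `(s ^ d) ^ p'` and the change of variables `x = t - s z` contributes `s
^ d`; this is the origin of the normalization `d (p' + 1)`. -/
theorem lintegral_envelope_mul (hw : Continuous w) (hsupp : Function.support w ⊆ cube d 1)
    {lam : EuclideanSpace ℝ (Fin d) → ℝ} (hlam : Continuous lam) (hlam0 : ∀ t, 0 ≤ lam t)
    {p p' c : ℝ} (hp : 1 ≤ p) (hp' : 1 ≤ p') (hc : 0 < c) {s : ℝ} (hs : 0 < s)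
    (ξ' t : EuclideanSpace ℝ (Fin d)) :
    ∫⁻ x, ENNReal.ofReal (‖envelope w p s (c * s) ξ' (t - x)‖ ^ p') * ENNReal.ofReal (lam x) =
      ENNReal.ofReal (s ^ ((d : ℝ) * (p' + 1)) * profile w lam p p' c s (s • ξ') t) := by
  set F : EuclideanSpace ℝ (Fin d) → ℝ := fun y => ‖envelope w p s (c * s) ξ' y‖ ^ p' with hF
  have hcs : 0 < c * s := mul_pos hc hs
  have hFc : Continuous F := (continuous_envelope hw hsupp hp s hcs ξ').norm.rpow_const
    fun _ => Or.inr (by linarith)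
  have hFs : HasCompactSupport F :=
    (hasCompactSupport_envelope hsupp hp hs hcs ξ').comp_left (g := fun z => ‖z‖ ^ p')
      (by simp [Real.zero_rpow (by linarith : p' ≠ 0)])
  have hF0 : ∀ y, 0 ≤ F y := fun y => by positivity
  have hint : Integrable fun y => F y * lam (t - y) :=
    (hFc.mul (hlam.comp (by fun_prop))).integrable_of_hasCompactSupport hFs.mul_right
  have hint' : Integrable fun x => F (t - x) * lam x := by
    have := hint.comp_sub_left t
    simpa using this
  have h1 : ∀ x, ENNReal.ofReal (F (t - x)) * ENNReal.ofReal (lam x) =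
      ENNReal.ofReal (F (t - x) * lam x) := fun x => (ENNReal.ofReal_mul (hF0 _)).symm
  change ∫⁻ x, ENNReal.ofReal (F (t - x)) * ENNReal.ofReal (lam x) = _
  simp only [h1]
  rw [← ofReal_integral_eq_lintegral_ofReal hint'
    (Eventually.of_forall fun x => mul_nonneg (hF0 _) (hlam0 _))]
  congr 1
  have h2 := integral_sub_left_eq_self (fun y => F y * lam (t - y)) volume t
  simp only [sub_sub_cancel] at h2
  have h3 := Measure.integral_comp_smul (volume : Measure (EuclideanSpace ℝ (Fin d)))
    (fun y => F y * lam (t - y)) s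
  rw [finrank_euclideanSpace_fin, abs_of_pos (by positivity), smul_eq_mul] at h3
  have h4 : ∀ z, F (s • z) = (s ^ d : ℝ) ^ p' * ‖envelope w p 1 c (s • ξ') z‖ ^ p' := by
    intro z
    rw [hF]
    simp only
    rw [envelope_smul w p c hs, norm_smul, Real.norm_of_nonneg (by positivity),
      Real.mul_rpow (by positivity) (norm_nonneg _)]
  simp only [h4, mul_assoc] at h3
  rw [integral_const_mul] at h3
  rw [h2]
  have hsd : (s : ℝ) ^ d ≠ 0 := by positivity
  have h5 : ∫ y, F y * lam (t - y) = s ^ d * ((s ^ d : ℝ) ^ p' *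
      profile w lam p p' c s (s • ξ') t) := by
    rw [profile, h3, ← mul_assoc, mul_inv_cancel₀ hsd, one_mul]
  rw [h5, ← mul_assoc]
  congr 1
  rw [mul_add, mul_one, Real.rpow_add hs, Real.rpow_mul hs.le, Real.rpow_natCast, mul_comm]

end Window

section Estimate

variable {d : ℕ} {Ω : Type*} [MeasurableSpace Ω] {P : Measure Ω} [IsProbabilityMeasure P]
  {lam : EuclideanSpace ℝ (Fin d) → ℝ} {τ τ' : ℕ → Ω → EuclideanSpace ℝ (Fin d)}
  {A : ℕ → Ω → ℝ} {w : EuclideanSpace ℝ (Fin d) → ℂ} {p p' : ℝ}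

omit [IsProbabilityMeasure P] in
theorem measurable_secondResponse (hY : IsCompoundPoisson P lam τ A)
    {g g' : EuclideanSpace ℝ (Fin d) → ℂ} (hg : Measurable g) (hg' : Measurable g') (p : ℝ) :
    Measurable fun z : Ω × EuclideanSpace ℝ (Fin d) => secondResponse τ A g p g' z.1 z.2 := by
  have h1 : Measurable fun z : (Ω × EuclideanSpace ℝ (Fin d)) × EuclideanSpace ℝ (Fin d) =>
      response τ A g z.1.1 z.2 := by
    unfold response
    refine Measurable.tsum fun j => ?_
    have h2 := hY.measurable j
    have h3 := hY.points.measurable j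
    fun_prop
  have h2 : StronglyMeasurable
      fun z : (Ω × EuclideanSpace ℝ (Fin d)) × EuclideanSpace ℝ (Fin d) =>
        (‖response τ A g z.1.1 z.2‖ ^ p) • g' (z.1.2 - z.2) :=
    ((h1.norm.pow_const p).smul (hg'.comp (by fun_prop))).stronglyMeasurable
  exact h2.integral_prod_right.measurable

omit [IsProbabilityMeasure P] in
theorem secondMoment_eq_toReal (hY : IsCompoundPoisson P lam τ A)
    {g g' : EuclideanSpace ℝ (Fin d) → ℂ} (hg : Measurable g) (hg' : Measurable g')
    (t : EuclideanSpace ℝ (Fin d)) :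
    secondMoment P τ A g p g' p' t =
      (∫⁻ ω, ENNReal.ofReal (‖secondResponse τ A g p g' ω t‖ ^ p') ∂P).toReal := by
  have h := (measurable_secondResponse hY hg hg' p).comp
    (by fun_prop : Measurable fun ω : Ω => (ω, t))
  have h' : Measurable fun ω => secondResponse τ A g p g' ω t := h
  exact integral_eq_lintegral_of_nonneg_ae (Eventually.of_forall fun ω => by positivity)
    (h'.norm.pow_const p').aestronglyMeasurable

theorem stronglyMeasurable_secondMoment (hY : IsCompoundPoisson P lam τ A)
    {g g' : EuclideanSpace ℝ (Fin d) → ℂ} (hg : Measurable g) (hg' : Measurable g') :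
    StronglyMeasurable (secondMoment P τ A g p g' p') := by
  have h : StronglyMeasurable (Function.uncurry fun (ω : Ω) (t : EuclideanSpace ℝ (Fin d)) =>
      ‖secondResponse τ A g p g' ω t‖ ^ p') :=
    ((measurable_secondResponse hY hg hg' p).norm.pow_const p').stronglyMeasurable
  exact h.integral_prod_left

/-- The moments depend on the points only through the intensity of the process. -/
theorem secondMoment_eq_of_same_intensity (hY : IsCompoundPoisson P lam τ A)
    (hY' : IsCompoundPoisson P lam τ' A) (hw : Continuous w)
    (hsupp : Function.support w ⊆ cube d 1) {b : ℝ} (hb : ∀ t, lam t ≤ b)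
    (hp : 1 ≤ p) (hp' : 1 ≤ p') (hA : ∫⁻ ω, ENNReal.ofReal (|A 0 ω| ^ (p * p')) ∂P ≠ ∞)
    {s s' : ℝ} (hs : 0 < s) (hs' : 0 < s') (ξ ξ' t : EuclideanSpace ℝ (Fin d)) :
    secondMoment P τ A (gabor w s ξ) p (gabor w s' ξ') p' t =
      secondMoment P τ' A (gabor w s ξ) p (gabor w s' ξ') p' t := by
  obtain ⟨M, hM0, hM⟩ := exists_norm_le hw hsupp
  have hg := (continuous_gabor hw s ξ).measurable
  have hg' := (continuous_gabor hw s' ξ').measurable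
  have hψ := integrable_gabor_sub hw hsupp hs' ξ' t
  rw [secondMoment_eq_toReal hY hg hg', secondMoment_eq_toReal hY' hg hg']
  simp only [secondResponse_eq hsupp hs hs']
  congr 1
  have hc : Continuous fun z : EuclideanSpace ℝ (Fin d) × EuclideanSpace ℝ (Fin d) =>
      gabor w s ξ (z.2 - z.1) := (continuous_gabor hw s ξ).comp (by fun_prop)
  exact hY.lintegral_shotPower_eq (measurableSet_window t (s + s'))
    (intensityMeasure_window_ne_top hb t (s + s')) hp hp' hM0
    (hg'.comp (by fun_prop)) hψ hY' hA (G := translates (gabor w s ξ)) hc.measurable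
    (fun u => (continuous_gabor hw s ξ).comp (by fun_prop))
    (fun x u => by rw [translates, norm_gabor]; exact hM _)

end Estimate

end Scattering

/-! ### The one-point approximation and its rate. -/

namespace Scattering

variable {d : ℕ} {Ω : Type*} [MeasurableSpace Ω] {P : Measure Ω} [IsProbabilityMeasure P]
  {lam : EuclideanSpace ℝ (Fin d) → ℝ} {τ : ℕ → Ω → EuclideanSpace ℝ (Fin d)}
  {A : ℕ → Ω → ℝ} {w : EuclideanSpace ℝ (Fin d) → ℂ} {p p' b : ℝ}

/-- The error made when only single points in the window are taken into account. -/
noncomputable def multipleError (P : Measure Ω) (lam : EuclideanSpace ℝ (Fin d) → ℝ)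
    (A : ℕ → Ω → ℝ) (w : EuclideanSpace ℝ (Fin d) → ℂ) (p p' M c s : ℝ)
    (t : EuclideanSpace ℝ (Fin d)) : ℝ≥0∞ :=
  ENNReal.ofReal ((M ^ p * ((c * s) ^ d * ∫ u, ‖w u‖)) ^ p') *
    ((∫⁻ ω, ENNReal.ofReal (|A 0 ω| ^ (p * p')) ∂P) *
      multiplicityMoment (intensityMeasure lam (window t (s + c * s))).toNNReal
        (⌈p * p' - 1⌉₊ + 1))

theorem shotPower_two_sided (hY : IsCompoundPoisson P lam τ A) (hw : Continuous w)
    (hsupp : Function.support w ⊆ cube d 1) (hlam : Continuous lam) (hlam0 : ∀ t, 0 ≤ lam t)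
    (hb : ∀ t, lam t ≤ b) (hp : 1 ≤ p) (hp' : 1 ≤ p') {M : ℝ} (hM0 : 0 ≤ M)
    (hM : ∀ t, ‖w t‖ ≤ M) {c : ℝ} (hc : 0 < c) {s : ℝ} (hs : 0 < s)
    (ξ ξ' t : EuclideanSpace ℝ (Fin d)) :
    ∫⁻ ω, ENNReal.ofReal
        (‖secondResponse τ A (gabor w s ξ) p (gabor w (c * s) ξ') ω t‖ ^ p') ∂P ≤
      (∫⁻ ω, ENNReal.ofReal (|A 0 ω| ^ (p * p')) ∂P) *
        ENNReal.ofReal (s ^ ((d : ℝ) * (p' + 1)) * profile w lam p p' c s (s • ξ') t) +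
        multipleError P lam A w p p' M c s t ∧
    (∫⁻ ω, ENNReal.ofReal (|A 0 ω| ^ (p * p')) ∂P) *
        ENNReal.ofReal (s ^ ((d : ℝ) * (p' + 1)) * profile w lam p p' c s (s • ξ') t) ≤
      ∫⁻ ω, ENNReal.ofReal
        (‖secondResponse τ A (gabor w s ξ) p (gabor w (c * s) ξ') ω t‖ ^ p') ∂P +
        multipleError P lam A w p p' M c s t := by
  have hcs : 0 < c * s := mul_pos hc hs
  have hκ := measurable_indicator_translates hw s (s + c * s) ξ t
  have hψ : Measurable fun u => gabor w (c * s) ξ' (t - u) :=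
    (continuous_gabor hw (c * s) ξ').measurable.comp (by fun_prop)
  have hψi := integrable_gabor_sub hw hsupp hcs ξ' t
  have hκB := indicator_translates_eq_zero (w := w) s (s + c * s) ξ t
  have hκM := norm_indicator_translates_le hM0 hM s (s + c * s) ξ t
  have hB := measurableSet_window t (s + c * s)
  have hfin := intensityMeasure_window_ne_top hb t (s + c * s)
  have h1 := hY.lintegral_shotPower_le hlam.measurable hB hfin hp hp' hM0 hκ hψ hψi hκB hκM
    (Nat.le_ceil (p * p' - 1))
  have h2 := hY.lintegral_singlePower_le hlam.measurable hB hfin hp hp' hκ hψ hψi hκB hκM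
    (m := ⌈p * p' - 1⌉₊)
  simp only [singlePower_eq hsupp hs hcs, lintegral_envelope_mul hw hsupp hlam hlam0 hp hp' hc hs,
    integral_norm_gabor_sub w hcs] at h1 h2
  simp only [secondResponse_eq hsupp hs hcs]
  exact ⟨h1, h2⟩

omit [IsProbabilityMeasure P] in
-- The second filter has `L¹` norm of order `s ^ d`, whose `p'`-th power is `s ^ (d p')`; the
-- truncated Poisson moment is of order `s ^ (2 d)`. This is one factor `s ^ d` beyond the
-- normalization. The cap `smax` bounds the Poisson rates, so one constant serves all scales.
theorem exists_multipleError_le (hA : ∫⁻ ω, ENNReal.ofReal (|A 0 ω| ^ (p * p')) ∂P ≠ ∞)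
    (hb0 : 0 ≤ b) (hb : ∀ t, lam t ≤ b) {M : ℝ} (hM0 : 0 ≤ M)
    {c : ℝ} (hc : 0 < c) (smax : ℝ) :
    ∃ C : ℝ, 0 ≤ C ∧ ∀ s, 0 < s → s ≤ smax → ∀ t : EuclideanSpace ℝ (Fin d),
      multipleError P lam A w p p' M c s t ≤
        ENNReal.ofReal (C * s ^ ((d : ℝ) * (p' + 1)) * s ^ d) := by
  have hrate : ∀ s, 0 < s → ∀ t : EuclideanSpace ℝ (Fin d),
      intensityMeasure lam (window t (s + c * s)) ≤
        ENNReal.ofReal (b * ((1 + c) * s) ^ d) := by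
    intro s hs t
    refine (intensityMeasure_window_le hb t _).trans (le_of_eq ?_)
    rw [ENNReal.ofReal_mul hb0, ENNReal.ofReal_pow (by positivity)]
    congr 3
    ring
  obtain ⟨D, hD, hDle⟩ := exists_lintegral_poissonMeasure_le
    (b * ((1 + c) * smax) ^ d).toNNReal (⌈p * p' - 1⌉₊ + 1)
  set Q := ∫⁻ ω, ENNReal.ofReal (|A 0 ω| ^ (p * p')) ∂P with hQ
  set W := ∫ u, ‖w u‖ with hW
  have hW0 : 0 ≤ W := integral_nonneg fun _ => norm_nonneg _
  refine ⟨(M ^ p * (c ^ d * W)) ^ p' * (Q.toReal * (D.toReal * (b * (1 + c) ^ d) ^ 2)),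
    by positivity, fun s hs hsm t => ?_⟩
  have hr : intensityMeasure lam (window t (s + c * s)) ≠ ∞ :=
    ne_top_of_le_ne_top ENNReal.ofReal_ne_top (hrate s hs t)
  have hrle : (intensityMeasure lam (window t (s + c * s))).toNNReal ≤
      (b * ((1 + c) * smax) ^ d).toNNReal := by
    rw [← ENNReal.coe_le_coe, ENNReal.coe_toNNReal hr]
    refine (hrate s hs t).trans (ENNReal.ofReal_le_ofReal ?_)
    gcongr
  have h1 := hDle _ hrle
  rw [ENNReal.coe_toNNReal hr] at h1
  have h2 : multiplicityMoment (intensityMeasure lam (window t (s + c * s))).toNNReal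
      (⌈p * p' - 1⌉₊ + 1) ≤ D * ENNReal.ofReal (b * ((1 + c) * s) ^ d) ^ 2 :=
    h1.trans (by gcongr; exact hrate s hs t)
  rw [multipleError]
  calc ENNReal.ofReal ((M ^ p * ((c * s) ^ d * W)) ^ p') *
        (Q * multiplicityMoment (intensityMeasure lam (window t (s + c * s))).toNNReal
          (⌈p * p' - 1⌉₊ + 1))
      ≤ ENNReal.ofReal ((M ^ p * ((c * s) ^ d * W)) ^ p') *
        (Q * (D * ENNReal.ofReal (b * ((1 + c) * s) ^ d) ^ 2)) := by gcongr
    _ = ENNReal.ofReal ((M ^ p * ((c * s) ^ d * W)) ^ p' *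
        (Q.toReal * (D.toReal * (b * ((1 + c) * s) ^ d) ^ 2))) := by
      conv_rhs =>
        rw [ENNReal.ofReal_mul (by positivity), ENNReal.ofReal_mul (by positivity),
          ENNReal.ofReal_mul (by positivity), ENNReal.ofReal_toReal hA, ENNReal.ofReal_toReal hD,
          ENNReal.ofReal_pow (by positivity)]
    _ = _ := by
      congr 1
      have e1 : (M ^ p * ((c * s) ^ d * W)) ^ p' =
          (M ^ p * (c ^ d * W)) ^ p' * s ^ ((d : ℝ) * p') := by
        rw [Real.rpow_mul hs.le, Real.rpow_natCast, ← Real.mul_rpow (by positivity) (by positivity),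
          mul_pow]
        ring_nf
      rw [e1, mul_add, mul_one, Real.rpow_add hs, Real.rpow_natCast, mul_pow (1 + c) s]
      ring

theorem lintegral_secondResponse_ne_top (hY : IsCompoundPoisson P lam τ A) (hw : Continuous w)
    (hsupp : Function.support w ⊆ cube d 1) (hlam : Continuous lam) (hlam0 : ∀ t, 0 ≤ lam t)
    (hb : ∀ t, lam t ≤ b) (hp : 1 ≤ p) (hp' : 1 ≤ p')
    (hA : ∫⁻ ω, ENNReal.ofReal (|A 0 ω| ^ (p * p')) ∂P ≠ ∞)
    {c : ℝ} (hc : 0 < c) {s : ℝ} (hs : 0 < s) (ξ ξ' t : EuclideanSpace ℝ (Fin d)) :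
    ∫⁻ ω, ENNReal.ofReal
      (‖secondResponse τ A (gabor w s ξ) p (gabor w (c * s) ξ') ω t‖ ^ p') ∂P ≠ ∞ := by
  obtain ⟨M, hM0, hM⟩ := exists_norm_le hw hsupp
  refine ne_top_of_le_ne_top (ENNReal.add_ne_top.mpr ⟨ENNReal.mul_ne_top hA
    ENNReal.ofReal_ne_top, ENNReal.mul_ne_top ENNReal.ofReal_ne_top (ENNReal.mul_ne_top hA
      (multiplicityMoment_ne_top _ _))⟩)
    (shotPower_two_sided hY hw hsupp hlam hlam0 hb hp hp' hM0 hM hc hs ξ ξ' t).1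

theorem integrable_secondResponse (hY : IsCompoundPoisson P lam τ A) (hw : Continuous w)
    (hsupp : Function.support w ⊆ cube d 1) (hlam : Continuous lam) (hlam0 : ∀ t, 0 ≤ lam t)
    (hb : ∀ t, lam t ≤ b) (hp : 1 ≤ p) (hp' : 1 ≤ p')
    (hA : ∫⁻ ω, ENNReal.ofReal (|A 0 ω| ^ (p * p')) ∂P ≠ ∞)
    {c : ℝ} (hc : 0 < c) {s : ℝ} (hs : 0 < s) (ξ ξ' t : EuclideanSpace ℝ (Fin d)) :
    Integrable (fun ω =>
      ‖secondResponse τ A (gabor w s ξ) p (gabor w (c * s) ξ') ω t‖ ^ p') P := by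
  have h := (measurable_secondResponse hY (continuous_gabor hw s ξ).measurable
    (continuous_gabor hw (c * s) ξ').measurable p).comp (by fun_prop : Measurable fun ω : Ω => (ω, t))
  have h' : Measurable fun ω => secondResponse τ A (gabor w s ξ) p (gabor w (c * s) ξ') ω t := h
  refine (lintegral_ofReal_ne_top_iff_integrable (h'.norm.pow_const p').aestronglyMeasurable
    (Eventually.of_forall fun ω => by positivity)).mp ?_
  exact lintegral_secondResponse_ne_top hY hw hsupp hlam hlam0 hb hp hp' hA hc hs ξ ξ' t

theorem abs_toReal_sub_le {x y e : ℝ≥0∞} (hx : x ≠ ∞) (hy : y ≠ ∞) (he : e ≠ ∞)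
    (h1 : x ≤ y + e) (h2 : y ≤ x + e) : |x.toReal - y.toReal| ≤ e.toReal := by
  have h3 := ENNReal.toReal_mono (ENNReal.add_ne_top.mpr ⟨hy, he⟩) h1
  have h4 := ENNReal.toReal_mono (ENNReal.add_ne_top.mpr ⟨hx, he⟩) h2
  rw [ENNReal.toReal_add hy he] at h3
  rw [ENNReal.toReal_add hx he] at h4
  rw [abs_le]
  constructor <;> linarith

theorem exists_abs_secondMoment_sub_le (hY : IsCompoundPoisson P lam τ A) (hw : Continuous w)
    (hsupp : Function.support w ⊆ cube d 1) (hlam : Continuous lam) (hlam0 : ∀ t, 0 ≤ lam t)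
    (hb : ∀ t, lam t ≤ b) (hp : 1 ≤ p) (hp' : 1 ≤ p')
    (hA : Integrable (fun ω => |A 0 ω| ^ (p * p')) P)
    {c : ℝ} (hc : 0 < c) (smax : ℝ) :
    ∃ C : ℝ, 0 ≤ C ∧ ∀ s, 0 < s → s ≤ smax → ∀ ξ ξ' t : EuclideanSpace ℝ (Fin d),
      |secondMoment P τ A (gabor w s ξ) p (gabor w (c * s) ξ') p' t /
          s ^ ((d : ℝ) * (p' + 1)) -
        profile w lam p p' c s (s • ξ') t * ∫ ω, |A 0 ω| ^ (p * p') ∂P| ≤ C * s ^ d := by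
  obtain ⟨M, hM0, hM⟩ := exists_norm_le hw hsupp
  have hAnn : 0 ≤ᵐ[P] fun ω => |A 0 ω| ^ (p * p') := Eventually.of_forall fun ω => by positivity
  have hQ := ofReal_integral_eq_lintegral_ofReal hA hAnn
  have hA' : ∫⁻ ω, ENNReal.ofReal (|A 0 ω| ^ (p * p')) ∂P ≠ ∞ := hQ ▸ ENNReal.ofReal_ne_top
  obtain ⟨C, hC0, hC⟩ := exists_multipleError_le (w := w) hA' ((hlam0 0).trans (hb 0)) hb hM0
    hc smax
  refine ⟨C, hC0, fun s hs hsm ξ ξ' t => ?_⟩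
  obtain ⟨h1, h2⟩ := shotPower_two_sided hY hw hsupp hlam hlam0 hb hp hp' hM0 hM hc hs ξ ξ' t
  have hle := hC s hs hsm t
  have hprof : 0 ≤ profile w lam p p' c s (s • ξ') t :=
    integral_nonneg fun z => mul_nonneg (by positivity) (hlam0 _)
  have hpow : 0 < s ^ ((d : ℝ) * (p' + 1)) := Real.rpow_pos_of_pos hs _
  have h3 := abs_toReal_sub_le
    (lintegral_secondResponse_ne_top hY hw hsupp hlam hlam0 hb hp hp' hA' hc hs ξ ξ' t)
    (ENNReal.mul_ne_top hA' ENNReal.ofReal_ne_top) ENNReal.ofReal_ne_top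
    (h1.trans (by gcongr)) (h2.trans (by gcongr))
  rw [← secondMoment_eq_toReal hY (continuous_gabor hw s ξ).measurable
    (continuous_gabor hw (c * s) ξ').measurable, ENNReal.toReal_mul, ← hQ,
    ENNReal.toReal_ofReal (integral_nonneg fun ω => by positivity),
    ENNReal.toReal_ofReal (by positivity), ENNReal.toReal_ofReal (by positivity)] at h3
  have h4 : secondMoment P τ A (gabor w s ξ) p (gabor w (c * s) ξ') p' t /
          s ^ ((d : ℝ) * (p' + 1)) -
        profile w lam p p' c s (s • ξ') t * ∫ ω, |A 0 ω| ^ (p * p') ∂P =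
      (secondMoment P τ A (gabor w s ξ) p (gabor w (c * s) ξ') p' t -
        (∫ ω, |A 0 ω| ^ (p * p') ∂P) *
          (s ^ ((d : ℝ) * (p' + 1)) * profile w lam p p' c s (s • ξ') t)) /
        s ^ ((d : ℝ) * (p' + 1)) := by
    field_simp
  rw [h4, abs_div, abs_of_pos hpow, div_le_iff₀ hpow]
  linarith

/-! ### Translation by a period of the intensity. -/

section Translation

omit [IsProbabilityMeasure P] in
/-- A compound Poisson process whose intensity is invariant under a translation may be
translated. -/
theorem IsCompoundPoisson.translate (hY : IsCompoundPoisson P lam τ A)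
    {v : EuclideanSpace ℝ (Fin d)} (hv : ∀ t, lam (t + v) = lam t) :
    IsCompoundPoisson P lam (fun j ω => τ j ω - v) A := by
  have hsub : Measurable fun x : EuclideanSpace ℝ (Fin d) => x - v := by fun_prop
  have hpm : ∀ B : Set (EuclideanSpace ℝ (Fin d)), MeasurableSet B → ∀ ω,
      pointMeasure (fun j ω => τ j ω - v) ω B =
        pointMeasure τ ω ((fun x => x - v) ⁻¹' B) := by
    intro B hB ω
    rw [pointMeasure_eq_hits hB, pointMeasure_eq_hits (hsub hB)]
    rfl
  have hint : ∀ B : Set (EuclideanSpace ℝ (Fin d)), MeasurableSet B →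
      intensityMeasure lam ((fun x => x - v) ⁻¹' B) = intensityMeasure lam B := by
    intro B hB
    have hl : ∀ t, lam (t - v) = lam t := fun t => by
      rw [← hv (t - v), sub_add_cancel]
    have h := (measurePreserving_sub_right (volume : Measure (EuclideanSpace ℝ (Fin d)))
      v).setLIntegral_comp_preimage_emb (measurableEmbedding_subRight v)
      (fun t => ENNReal.ofReal (lam t)) B
    simp only [hl] at h
    exact h
  refine ⟨⟨fun j => hsub.comp (hY.points.measurable j), ?_, ?_⟩, hY.measurable, hY.iIndep,
    hY.identDistrib, ?_⟩
  · intro B hB hfin n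
    simp only [hpm B hB, ← hint B hB]
    exact hY.points.poisson _ (hsub hB) (by rwa [hint B hB]) n
  · intro m B hB hdis
    simp only [hpm _ (hB _)]
    exact hY.points.indep m _ (fun i => hsub (hB i)) fun i j hij => (hdis i j hij).preimage _
  · exact hY.indep_points.comp measurable_id
      (measurable_pi_lambda (fun (x : ℕ → EuclideanSpace ℝ (Fin d)) j => x j - v)
        fun j => hsub.comp (measurable_pi_apply j))

omit [IsProbabilityMeasure P] in
theorem secondMoment_translate (v t : EuclideanSpace ℝ (Fin d))
    (g g' : EuclideanSpace ℝ (Fin d) → ℂ) :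
    secondMoment P τ A g p g' p' (t + v) =
      secondMoment P (fun j ω => τ j ω - v) A g p g' p' t := by
  unfold secondMoment
  refine integral_congr_ae (Eventually.of_forall fun ω => ?_)
  simp only
  congr 2
  rw [secondResponse, secondResponse, convolution_def, convolution_def,
    ← integral_add_right_eq_self _ v]
  refine integral_congr_ae (Eventually.of_forall fun u => ?_)
  have h : response τ A g ω (u + v) = response (fun j ω => τ j ω - v) A g ω u := by
    unfold response
    refine tsum_congr fun j => ?_
    rw [show u + v - τ j ω = u - (τ j ω - v) by abel]
  simp only [h, add_sub_add_right_eq_sub]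

end Translation

end Scattering

/-! ### Averages of periodic functions over large cubes. -/

namespace Scattering

section Averaging
variable {d : ℕ} {S : EuclideanSpace ℝ (Fin d) → ℝ} {T C : ℝ}

/-- The half-open cell of side `T` with index `a`. -/
def cell (T : ℝ) (a : Fin d → ℤ) : Set (EuclideanSpace ℝ (Fin d)) :=
  {t | ∀ i, t i ∈ Set.Ico (a i * T) ((a i + 1) * T)}

theorem measurableSet_cell (T : ℝ) (a : Fin d → ℤ) : MeasurableSet (cell T a) := by
  unfold cell
  rw [Set.ofPred_forall]
  exact MeasurableSet.iInter fun i => (by fun_prop : Measurable fun t : EuclideanSpace ℝ (Fin d) =>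
    t i) measurableSet_Ico

/-- The periods of `S` form an additive subgroup, which contains the lattice as soon as it contains
its generators. -/
theorem periodic_lattice (hper : ∀ t i, S (t + EuclideanSpace.single i T) = S t)
    (a : Fin d → ℤ) (t : EuclideanSpace ℝ (Fin d)) :
    S (t + WithLp.toLp 2 fun i => (a i : ℝ) * T) = S t := by
  let G : AddSubgroup (EuclideanSpace ℝ (Fin d)) :=
    { carrier := {v | ∀ t, S (t + v) = S t}
      zero_mem' := fun t => by rw [add_zero]
      add_mem' := fun {v v'} hv hv' t => by rw [← add_assoc, hv', hv]
      neg_mem' := fun {v} hv t => by rw [← hv (t + -v), neg_add_cancel_right] }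
  have h : (WithLp.toLp 2 fun i => (a i : ℝ) * T : EuclideanSpace ℝ (Fin d)) ∈ G := by
    have he : (WithLp.toLp 2 fun i => (a i : ℝ) * T : EuclideanSpace ℝ (Fin d)) =
        ∑ i, a i • EuclideanSpace.single i T := by
      ext j
      simp [Pi.single_apply]
    rw [he]
    exact G.sum_mem fun i _ => G.zsmul_mem (fun t => hper t i) _
  exact h t

theorem setIntegral_cell (hper : ∀ t i, S (t + EuclideanSpace.single i T) = S t)
    (a : Fin d → ℤ) : ∫ t in cell T a, S t = ∫ t in cell T (0 : Fin d → ℤ), S t := by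
  set v : EuclideanSpace ℝ (Fin d) := WithLp.toLp 2 fun i => (a i : ℝ) * T with hv
  have hS : ∀ t, S (t - v) = S t := fun t => by
    rw [← periodic_lattice hper a (t - v), sub_add_cancel]
  have h := (measurePreserving_sub_right (volume : Measure (EuclideanSpace ℝ (Fin d)))
    v).setIntegral_preimage_emb (measurableEmbedding_subRight v) S (cell T (0 : Fin d → ℤ))
  simp only [hS] at h
  rw [← h]
  congr 2
  ext t
  simp only [cell, hv, Set.mem_Ico, Set.mem_ofPred_eq, Set.mem_preimage, PiLp.sub_apply,
    Pi.zero_apply]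
  refine forall_congr' fun i => and_congr ?_ ?_ <;> constructor <;> intro h <;> push_cast at * <;>
    linarith

theorem iUnion_cell (hT : 0 < T) (n : ℕ) :
    ⋃ a ∈ Fintype.piFinset fun _ : Fin d => Finset.Ico (-(n : ℤ)) n, cell T a =
      {t | ∀ i, t i ∈ Set.Ico (-(n * T)) (n * T)} := by
  ext t
  simp only [Set.mem_iUnion, Fintype.mem_piFinset, Finset.mem_Ico, exists_prop, cell,
    Set.mem_ofPred_eq, Set.mem_Ico]
  constructor
  · rintro ⟨a, ha, ht⟩ i
    have h1 : (-(n : ℝ)) ≤ a i := by exact_mod_cast (ha i).1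
    have h2 : (a i : ℝ) + 1 ≤ n := by exact_mod_cast (ha i).2
    constructor
    · nlinarith [(ht i).1]
    · nlinarith [(ht i).2]
  · intro ht
    refine ⟨fun i => ⌊t i / T⌋, fun i => ⟨?_, ?_⟩, fun i => ⟨?_, ?_⟩⟩
    · rw [Int.le_floor, le_div_iff₀ hT]
      push_cast
      linarith [(ht i).1]
    · rw [Int.floor_lt, div_lt_iff₀ hT]
      exact_mod_cast (ht i).2
    · rw [← le_div_iff₀ hT]
      exact Int.floor_le _
    · rw [← div_lt_iff₀ hT]
      exact Int.lt_floor_add_one _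

theorem pairwise_disjoint_cell (hT : 0 < T) :
    Pairwise (Function.onFun Disjoint (cell T : (Fin d → ℤ) → Set (EuclideanSpace ℝ (Fin d)))) := by
  intro a a' hne
  refine Set.disjoint_left.mpr fun t h1 h2 => hne ?_
  have hfl : ∀ b : Fin d → ℤ, t ∈ cell T b → ∀ i, ⌊t i / T⌋ = b i := by
    intro b hb i
    rw [Int.floor_eq_iff, le_div_iff₀ hT, div_lt_iff₀ hT]
    exact hb i
  funext i
  rw [← hfl a h1, ← hfl a' h2]

/-- The half-open cell and the closed cube have the same finite volume, so they differ by a null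
set. -/
theorem setIntegral_cell_zero (T : ℝ) (S : EuclideanSpace ℝ (Fin d) → ℝ) :
    ∫ t in cell T (0 : Fin d → ℤ), S t = ∫ t in cube d T, S t := by
  have he : cell T (0 : Fin d → ℤ) = {t | ∀ i, t i ∈ Set.Ico 0 T} := by
    simp [cell]
  refine setIntegral_congr_set (ae_eq_of_subset_of_measure_ge ?_ ?_ ?_ ?_)
  · rw [he]
    exact fun t ht i => ⟨(ht i).1, (ht i).2.le⟩
  · rw [he, volume_box measurableSet_Ico, volume_cube, Real.volume_Ico, sub_zero]
  · exact (measurableSet_cell T 0).nullMeasurableSet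
  · rw [volume_cube]
    simp

theorem setIntegral_iUnion_cell (hT : 0 < T) (hS : LocallyIntegrable S)
    (hper : ∀ t i, S (t + EuclideanSpace.single i T) = S t) (n : ℕ) :
    ∫ t in {t : EuclideanSpace ℝ (Fin d) | ∀ i, t i ∈ Set.Ico (-(n * T)) (n * T)}, S t =
      (2 * n) ^ d * ∫ t in cube d T, S t := by
  have hsub : ∀ a : Fin d → ℤ, IntegrableOn S (cell T a) := by
    intro a
    have hint : IntegrableOn S (WithLp.toLp 2 '' Set.univ.pi fun i : Fin d =>
        Set.Icc (a i * T) ((a i + 1) * T)) :=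
      hS.integrableOn_isCompact ((isCompact_univ_pi fun _ => isCompact_Icc).image
        (PiLp.continuous_toLp 2 _))
    exact hint.mono_set fun t ht => ⟨WithLp.ofLp t, fun i _ => ⟨(ht i).1, (ht i).2.le⟩, rfl⟩
  rw [← iUnion_cell hT, integral_biUnion_finset _ (fun a _ => measurableSet_cell T a)
    (fun a _ a' _ h => pairwise_disjoint_cell hT h) (fun a _ => hsub a)]
  simp only [setIntegral_cell hper, setIntegral_cell_zero T, Finset.sum_const, nsmul_eq_mul]
  congr 1
  rw [Fintype.card_piFinset]
  have hn : ((n : ℤ) - -(n : ℤ)).toNat = 2 * n := by omega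
  simp only [Int.card_Ico, hn, Finset.prod_const, Finset.card_univ, Fintype.card_fin]
  push_cast
  rfl

theorem locallyIntegrable_of_abs_le (hS : StronglyMeasurable S) (hC : ∀ t, |S t| ≤ C) :
    LocallyIntegrable S :=
  (continuous_const (y := C)).locallyIntegrable.mono hS.aestronglyMeasurable
    (Eventually.of_forall fun t => (hC t).trans (le_abs_self C))

/-- Inside the cube of half-side `R` sits a block of `(2n)^d` whole cells, `n = ⌊R / T⌋`, on which
the integral is exact. The remaining shell has relative volume `1 - (n T / R)^d → 0` and the
integrand is bounded by `C`. -/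
theorem hasInvariantMoment_of_periodic (hT : 0 < T) (hS : StronglyMeasurable S)
    (hC : ∀ t, |S t| ≤ C) (hper : ∀ t i, S (t + EuclideanSpace.single i T) = S t) :
    HasInvariantMoment S ((T ^ d)⁻¹ * ∫ t in cube d T, S t) := by
  have hloc := locallyIntegrable_of_abs_le hS hC
  refine ⟨hloc, ?_⟩
  set I := ∫ t in cube d T, S t with hI
  set ρ : ℝ → ℝ := fun R => (⌊R / T⌋₊ : ℝ) / (R / T) with hρ
  have hρlim : Tendsto ρ atTop (𝓝 1) :=
    (tendsto_nat_floor_div_atTop (R := ℝ)).comp (tendsto_id.atTop_div_const hT)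
  have hmain : Tendsto (fun R => ρ R ^ d * ((T ^ d)⁻¹ * I)) atTop (𝓝 ((T ^ d)⁻¹ * I)) := by
    simpa using (hρlim.pow d).mul_const ((T ^ d)⁻¹ * I)
  have herr : Tendsto (fun R => C * (1 - ρ R ^ d)) atTop (𝓝 0) := by
    simpa using ((tendsto_const_nhds (x := (1 : ℝ))).sub (hρlim.pow d)).const_mul C
  refine hmain.congr_dist ?_
  refine squeeze_zero' (Eventually.of_forall fun _ => dist_nonneg) ?_ herr
  filter_upwards [eventually_gt_atTop 0] with R hR
  set n := ⌊R / T⌋₊ with hn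
  have hnR : (n : ℝ) * T ≤ R := by
    rw [← le_div_iff₀ hT]
    exact Nat.floor_le (by positivity)
  set D : Set (EuclideanSpace ℝ (Fin d)) := {t | ∀ i, t i ∈ Set.Ico (-(n * T)) (n * T)} with hD
  have hDm : MeasurableSet D := measurableSet_box measurableSet_Ico
  have hDsub : D ⊆ centredCube d R := by
    rw [centredCube_eq_box]
    exact fun t ht i => ⟨by linarith [(ht i).1], by linarith [(ht i).2]⟩
  have hcm : MeasurableSet (centredCube d R) := by
    rw [centredCube_eq_box]
    exact measurableSet_box measurableSet_Icc
  have hvc : volume (centredCube d R) = ENNReal.ofReal ((2 * R) ^ d) := by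
    rw [centredCube_eq_box, volume_box measurableSet_Icc, Real.volume_Icc,
      ENNReal.ofReal_pow (by positivity)]
    congr 2
    ring
  have hvD : volume D = ENNReal.ofReal ((2 * (n * T)) ^ d) := by
    rw [hD, volume_box measurableSet_Ico, Real.volume_Ico, ENNReal.ofReal_pow (by positivity)]
    congr 2
    ring
  have hint : IntegrableOn S (centredCube d R) := by
    refine ⟨hS.aestronglyMeasurable, HasFiniteIntegral.restrict_of_bounded (C := C) ?_ ?_⟩
    · rw [hvc]
      exact ENNReal.ofReal_lt_top
    · exact Eventually.of_forall hC
  have hdiff : ∫ t in centredCube d R \ D, S t =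
      (∫ t in centredCube d R, S t) - (2 * n) ^ d * I := by
    rw [setIntegral_sdiff hDm hint hDsub, setIntegral_iUnion_cell hT hloc hper]
  have hle : |(∫ t in centredCube d R, S t) - (2 * n) ^ d * I| ≤
      C * ((2 * R) ^ d - (2 * (n * T)) ^ d) := by
    rw [← hdiff]
    have hv : volume.real (centredCube d R \ D) = (2 * R) ^ d - (2 * (n * T)) ^ d := by
      rw [measureReal_sdiff hDsub hDm (by rw [hvc]; exact ENNReal.ofReal_ne_top), Measure.real,
        Measure.real, hvc, hvD, ENNReal.toReal_ofReal (by positivity),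
        ENNReal.toReal_ofReal (by positivity)]
    rw [← hv]
    refine norm_setIntegral_le_of_norm_le_const (f := S) ?_ fun t _ => hC t
    exact (measure_mono Set.sdiff_subset).trans_lt (by rw [hvc]; exact ENNReal.ofReal_lt_top)
  have hRd : (0 : ℝ) < (2 * R) ^ d := by positivity
  have hρR : ρ R = n * T / R := by
    rw [hρ]
    simp only [← hn]
    field_simp
  have e1 : ρ R ^ d * ((T ^ d)⁻¹ * I) = ((2 * R) ^ d)⁻¹ * ((2 * n) ^ d * I) := by
    rw [hρR, div_pow, mul_pow, mul_pow, mul_pow]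
    field_simp
  have e2 : C * (1 - ρ R ^ d) = ((2 * R) ^ d)⁻¹ * (C * ((2 * R) ^ d - (2 * (n * T)) ^ d)) := by
    rw [hρR, div_pow, mul_pow 2 R, mul_pow 2 (n * T : ℝ)]
    field_simp
  rw [dist_comm, Real.dist_eq, e1, e2, ← mul_sub, abs_mul, abs_of_pos (inv_pos.mpr hRd)]
  exact mul_le_mul_of_nonneg_left hle (by positivity)

end Averaging

end Scattering

/-! ### The theorem. -/

open Scattering
theorem theorem4 {d : ℕ} (hd : 0 < d) {Ω : Type*} [MeasurableSpace Ω]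
    (P : Measure Ω) [IsProbabilityMeasure P]
    (w : EuclideanSpace ℝ (Fin d) → ℂ) (hw : Continuous w)
    (hw_supp : Function.support w ⊆ cube d 1)
    (lam : EuclideanSpace ℝ (Fin d) → ℝ) (hlam : Continuous lam)
    (hlam_min : ∃ a : ℝ, 0 < a ∧ ∀ t, a ≤ lam t) (hlam_max : ∃ b : ℝ, ∀ t, lam t ≤ b)
    (τ : ℕ → Ω → EuclideanSpace ℝ (Fin d)) (A : ℕ → Ω → ℝ)
    (hY : IsCompoundPoisson P lam τ A)
    (p p' q : ℝ) (hp : 1 ≤ p) (hp' : 1 ≤ p') (hq : q = p * p')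
    (hA : Integrable (fun ω => |A 0 ω| ^ q) P)
    (s s' : ℕ → ℝ) (ξ ξ' : ℕ → EuclideanSpace ℝ (Fin d)) (c : ℝ) (hc : 0 < c)
    (hs : ∀ k, 0 < s k) (hs' : ∀ k, s' k = c * s k) (hs_lim : Tendsto s atTop (𝓝 0))
    (L : EuclideanSpace ℝ (Fin d)) (hL : Tendsto (fun k => s' k • ξ' k) atTop (𝓝 L)) :
    (∀ k t, Integrable (fun ω =>
        ‖secondResponse τ A (gabor w (s k) (ξ k)) p (gabor w (s' k) (ξ' k)) ω t‖ ^ p') P) ∧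
    (∀ t, Tendsto (fun k =>
        secondMoment P τ A (gabor w (s k) (ξ k)) p (gabor w (s' k) (ξ' k)) p' t /
          s k ^ ((d : ℝ) * (p' + 1)))
        atTop (𝓝 (constK w p p' c L * lam t * ∫ ω, |A 0 ω| ^ q ∂P))) ∧
    (∀ T : ℝ, 0 < T → (∀ t i, lam (t + EuclideanSpace.single i T) = lam t) →
      ∃ SY : ℕ → ℝ,
        (∀ k, HasInvariantMoment
          (secondMoment P τ A (gabor w (s k) (ξ k)) p (gabor w (s' k) (ξ' k)) p') (SY k)) ∧
        Tendsto (fun k => SY k / s k ^ ((d : ℝ) * (p' + 1))) atTop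
          (𝓝 (constK w p p' c L * meanIntensity lam T * ∫ ω, |A 0 ω| ^ q ∂P))) := by
  obtain ⟨a, ha, halam⟩ := hlam_min
  obtain ⟨b, hb⟩ := hlam_max
  have hlam0 : ∀ t, 0 ≤ lam t := fun t => ha.le.trans (halam t)
  obtain rfl : s' = fun k => c * s k := funext hs'
  subst hq
  have hA' : ∫⁻ ω, ENNReal.ofReal (|A 0 ω| ^ (p * p')) ∂P ≠ ∞ := by
    rw [← ofReal_integral_eq_lintegral_ofReal hA (Eventually.of_forall fun ω => by positivity)]
    exact ENNReal.ofReal_ne_top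
  obtain ⟨smax, hsmax⟩ := hs_lim.bddAbove_range
  have hsm : ∀ k, s k ≤ smax := fun k => hsmax ⟨k, rfl⟩
  obtain ⟨C, hC0, hC⟩ :=
    exists_abs_secondMoment_sub_le hY hw hw_supp hlam hlam0 hb hp hp' hA hc smax
  have hη : Tendsto (fun k => s k • ξ' k) atTop (𝓝 (c⁻¹ • L)) := by
    have h := hL.const_smul c⁻¹
    simpa only [smul_smul, inv_mul_cancel_left₀ hc.ne'] using h
  set Q := ∫ ω, |A 0 ω| ^ (p * p') ∂P with hQ
  have hQ0 : 0 ≤ Q := integral_nonneg fun ω => by positivity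
  set S : ℕ → EuclideanSpace ℝ (Fin d) → ℝ := fun k =>
    secondMoment P τ A (gabor w (s k) (ξ k)) p (gabor w (c * s k) (ξ' k)) p' with hS
  have hdiff : ∀ k t, |S k t / s k ^ ((d : ℝ) * (p' + 1)) -
      profile w lam p p' c (s k) (s k • ξ' k) t * Q| ≤ C * s k ^ d := fun k t =>
    hC (s k) (hs k) (hsm k) (ξ k) (ξ' k) t
  have hpt : ∀ t, Tendsto (fun k => S k t / s k ^ ((d : ℝ) * (p' + 1))) atTop
      (𝓝 (constK w p p' c L * lam t * Q)) := by
    intro t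
    have h1 := (tendsto_profile hw hw_supp hlam hlam0 hb hp hp' hc hs_lim hη t).mul_const Q
    rw [← constK_eq hw hw_supp hp hp' hc L] at h1
    refine h1.congr_dist (squeeze_zero (fun _ => dist_nonneg) (fun k => ?_)
      (g := fun k => C * s k ^ d) ?_)
    · rw [dist_comm, Real.dist_eq]
      exact hdiff k t
    -- Positive dimension is essential here: for `d = 0` the error bound `C * s k ^ d` would not
    -- tend to zero.
    · simpa [hd.ne'] using (hs_lim.pow d).const_mul C
  refine ⟨fun k t => integrable_secondResponse hY hw hw_supp hlam hlam0 hb hp hp' hA' hc (hs k)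
    (ξ k) (ξ' k) t, hpt, fun T hT hper => ?_⟩
  set J := ∫ z, envelopeBound w p c z ^ p' * b with hJ
  -- This bound serves twice: for fixed `k` it bounds the moment in the averaging over cubes, and
  -- uniformly in `k` it dominates the integrals over one period.
  have hbound : ∀ k t, |S k t / s k ^ ((d : ℝ) * (p' + 1))| ≤ C * smax ^ d + J * Q := by
    intro k t
    have h1 := abs_profile_le hw hw_supp hlam0 hb hp hp' hc (s k) (s k • ξ' k) t
    have h2 : C * s k ^ d ≤ C * smax ^ d := by
      gcongr
      · exact (hs k).le
      · exact hsm k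
    have h3 : |profile w lam p p' c (s k) (s k • ξ' k) t * Q| ≤ J * Q := by
      rw [abs_mul, abs_of_nonneg hQ0]
      exact mul_le_mul_of_nonneg_right h1 hQ0
    have h4 := abs_add_le (S k t / s k ^ ((d : ℝ) * (p' + 1)) -
      profile w lam p p' c (s k) (s k • ξ' k) t * Q)
      (profile w lam p p' c (s k) (s k • ξ' k) t * Q)
    rw [sub_add_cancel] at h4
    linarith [hdiff k t]
  have hSm : ∀ k, StronglyMeasurable (S k) := fun k =>
    stronglyMeasurable_secondMoment hY (continuous_gabor hw _ _).measurable
      (continuous_gabor hw _ _).measurable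
  have hpow : ∀ k, 0 < s k ^ ((d : ℝ) * (p' + 1)) := fun k => Real.rpow_pos_of_pos (hs k) _
  refine ⟨fun k => (T ^ d)⁻¹ * ∫ t in cube d T, S k t, fun k => ?_, ?_⟩
  · refine hasInvariantMoment_of_periodic
      (C := (C * smax ^ d + J * Q) * s k ^ ((d : ℝ) * (p' + 1))) hT (hSm k) (fun t => ?_)
      fun t i => ?_
    · have h := hbound k t
      rwa [abs_div, abs_of_pos (hpow k), div_le_iff₀ (hpow k)] at h
    · have hv : ∀ t, lam (t + EuclideanSpace.single i T) = lam t := fun t => hper t i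
      -- Shifting the observation point by a period amounts to shifting the process, which leaves
      -- its intensity, and therefore its moments, unchanged.
      change secondMoment P τ A _ p _ p' (t + EuclideanSpace.single i T) = _
      rw [secondMoment_translate]
      exact (secondMoment_eq_of_same_intensity hY (hY.translate hv) hw hw_supp hb hp hp' hA' (hs k)
        (mul_pos hc (hs k)) (ξ k) (ξ' k) t).symm
  · have hlimit : Tendsto (fun k => ∫ t in cube d T, S k t / s k ^ ((d : ℝ) * (p' + 1))) atTop
        (𝓝 (∫ t in cube d T, constK w p p' c L * lam t * Q)) := by
      refine tendsto_integral_of_dominated_convergence (fun _ => C * smax ^ d + J * Q)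
        (fun k => ?_) ?_ (fun k => Eventually.of_forall (hbound k)) (Eventually.of_forall hpt)
      · exact ((hSm k).measurable.div_const _).aestronglyMeasurable
      · refine integrableOn_const ?_
        rw [volume_cube]
        simp
    have h := hlimit.const_mul (T ^ d)⁻¹
    rw [integral_mul_const, integral_const_mul] at h
    simp only [integral_div] at h
    rw [meanIntensity]
    convert h using 2
    · rw [mul_div_assoc]
    · ring
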